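/- Let a finite graph be drawn on a closed surface (orientable or not), with every face a disc, and place a qubit on every edge. Boundaries of the lattice are allowed: some faces (smooth holes) and some vertices (rough holes) may be declared to be holes. For a vertex $s$ let $A_s=\prod_{i}\sigma^x_i$, the product over the legs of $s$, and for a face $p$ let $B_p=\prod_i\sigma^z_i$, the product along the boundary of $p$ (with multiplicity in both cases). Let $H=-U\sum_s A_s-J\sum_p B_p$ with $U,J>0$, the sums being over the vertices and faces that are not holes, and let $|\psi\rangle$ be any ground state of $H$, i.e. any normalised eigenvector for the lowest eigenvalue. A set of edges is viewed as the closed region formed by the quadrilaterals of its edges, where the quadrilateral of an edge has as corners the two ends of the edge and the midpoints of the two adjacent faces. Let $A$ be a region that is a closed disc, that is, connected (through sides of quadrilaterals), simply connected, with nonempty boundary, and with a boundary that nowhere touches itself; assume that no vertex or face incident with an edge of $A$ is a hole. Let $B$ be the set of all the other edges. Let $A=A_1\sqcup A_2$ and $B=B_1\sqcup B_2$, where $A_2$ shares no border with $B$ and $B_2$ shares no border with $A$: no vertex and no face is incident both with an edge of $A_2$ and with an edge of $B$, and none both with an edge of $B_2$ and with an edge of $A$. Let $n_{AB}$ be the number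 of plaquettes spanning the boundary between $A$ and $B$, i.e. of faces incident with an edge of $A$ and with an edge of $B$. Let $\rho_{A_1B_1}=\mathrm{tr}_{A_2B_2}|\psi\rangle\langle\psi|$, and for a state $\rho_{XY}$ let $E_{\mathcal N}^{X|Y}(\rho_{XY})=\log_2\mathrm{tr}\,|\rho_{XY}^{T_X}|$, where $|M|=\sqrt{M^\dagger M}$ and $T_X$ is the partial transpose. Then $$E_{\mathcal N}^{A_1|B_1}(\rho_{A_1B_1})=n_{AB}-1=E_{\mathcal N}^{A|B}(|\psi\rangle\langle\psi|),$$ so the entanglement across the boundary survives the tracing out of $A_2$ and $B_2$. -/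

import Mathlib

open scoped Matrix

noncomputable section

/-! ### Lattices on surfaces -/

/-- A finite lattice (graph with vertices, edges and faces) drawn on a closed surface, orientable or
not, given by its flags: a flag is a mutually incident triple (vertex, edge, face), i.e. one triangle
of the barycentric subdivision. `a0`, `a1`, `a2` send a flag to the adjacent flag that differs from
it in the vertex, in the edge, in the face respectively. -/
structure SurfaceLattice (Φ : Type*) where
  a0 : Φ → Φ
  a1 : Φ → Φ
  a2 : Φ → Φ
  a0_invol : ∀ x, a0 (a0 x) = x
  a1_invol : ∀ x, a1 (a1 x) = x
  a2_invol : ∀ x, a2 (a2 x) = x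
  a0_ne : ∀ x, a0 x ≠ x
  a1_ne : ∀ x, a1 x ≠ x
  a2_ne : ∀ x, a2 x ≠ x
  a0_a2_comm : ∀ x, a0 (a2 x) = a2 (a0 x)
  a0_a2_ne : ∀ x, a0 (a2 x) ≠ x

namespace SurfaceLattice

variable {Φ : Type*} (C : SurfaceLattice Φ)

/-- Vertices: orbits of flags under changing edge and face. -/
def Vertex : Type _ := Quot fun x y : Φ => y = C.a1 x ∨ y = C.a2 x

/-- Edges: orbits of flags under changing vertex and face (four flags each). -/
def Edge : Type _ := Quot fun x y : Φ => y = C.a0 x ∨ y = C.a2 x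

/-- Faces: orbits of flags under changing vertex and edge. -/
def Face : Type _ := Quot fun x y : Φ => y = C.a0 x ∨ y = C.a1 x

/-- The vertex, the edge and the face of a flag. -/
def vertex (x : Φ) : C.Vertex := Quot.mk _ x

def edge (x : Φ) : C.Edge := Quot.mk _ x

def face (x : Φ) : C.Face := Quot.mk _ x

instance [Finite Φ] : Fintype C.Vertex :=
  @Fintype.ofFinite _ (inferInstanceAs (Finite (Quot _)))

instance [Finite Φ] : Fintype C.Edge :=
  @Fintype.ofFinite _ (inferInstanceAs (Finite (Quot _)))

instance [Finite Φ] : Fintype C.Face :=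
  @Fintype.ofFinite _ (inferInstanceAs (Finite (Quot _)))

instance : DecidableEq C.Vertex := Classical.decEq _

instance : DecidableEq C.Edge := Classical.decEq _

instance : DecidableEq C.Face := Classical.decEq _

/-- The number of legs of the vertex `v` that belong to the edge `e` (2 if `e` is a loop at `v`);
each leg consists of two flags. -/
def legs (v : C.Vertex) (e : C.Edge) : ℕ :=
  Nat.card {x : Φ // C.vertex x = v ∧ C.edge x = e} / 2

/-- The number of times that the boundary walk of the face `p` runs along the edge `e`;
each passage consists of two flags. -/
def sides (p : C.Face) (e : C.Edge) : ℕ :=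
  Nat.card {x : Φ // C.face x = p ∧ C.edge x = e} / 2

/-- The vertex `v` is an end of some edge of the region `R`. -/
def StarMeets (v : C.Vertex) (R : Finset C.Edge) : Prop :=
  ∃ x, C.vertex x = v ∧ C.edge x ∈ R

/-- Some edge of the region `R` lies on the boundary of the face `p`. -/
def PlaquetteMeets (p : C.Face) (R : Finset C.Edge) : Prop :=
  ∃ x, C.face x = p ∧ C.edge x ∈ R

/-- Two regions share no border: no star and no plaquette reaches into both. -/
def NoBorder (R R' : Finset C.Edge) : Prop :=
  (∀ v, ¬ (C.StarMeets v R ∧ C.StarMeets v R')) ∧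
    ∀ p, ¬ (C.PlaquetteMeets p R ∧ C.PlaquetteMeets p R')

/-! ### Regions as subsets of the surface

Joining the ends of every edge to the midpoints of its two faces cuts the surface into
quadrilaterals, one for every edge, with corners vertex, face, vertex, face. The four sides of the
quadrilateral of `e` are the flags `x` of `e`, the side `x` joining the corners `vertex x` and
`face x`, and the side `x` is glued to the side `a1 x`. A set of edges thus is the closed region
formed by its quadrilaterals. -/

/-- `C.IsPath R v w l`: in the region `R` the sides listed in `l` lead, in this order, from the
vertex `v` to the vertex `w` (alternately from a vertex to a face and from a face to a vertex). -/
inductive IsPath (R : Finset C.Edge) : C.Vertex → C.Vertex → List Φ → Prop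
  | nil (v : C.Vertex) : IsPath R v v []
  | cons (x y : Φ) (w : C.Vertex) (l : List Φ) (hx : C.edge x ∈ R) (hy : C.edge y ∈ R)
      (hxy : C.face x = C.face y) (hl : IsPath R (C.vertex y) w l) :
      IsPath R (C.vertex x) w (x :: y :: l)

/-- Elementary deformations of a path: giving a side its other name, removing a backtracking, and
pushing two consecutive sides across a quadrilateral. -/
inductive Move : List Φ → List Φ → Prop
  | side (l r : List Φ) (x : Φ) : Move (l ++ x :: r) (l ++ C.a1 x :: r)
  | backtrack (l r : List Φ) (x : Φ) : Move (l ++ x :: x :: r) (l ++ r)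
  | square (l r : List Φ) (x : Φ) (hl : Even l.length) :
      Move (l ++ x :: C.a0 x :: r) (l ++ C.a2 x :: C.a2 (C.a0 x) :: r)

/-- Homotopy, inside the region `R`, of closed paths based at `v`. -/
def Homotopic (R : Finset C.Edge) (v : C.Vertex) : List Φ → List Φ → Prop :=
  Relation.EqvGen fun l m => C.IsPath R v v l ∧ C.IsPath R v v m ∧ C.Move l m

/-- Every closed path in the region can be contracted to a point inside the region. -/
def SimplyConnected (R : Finset C.Edge) : Prop :=
  ∀ (v : C.Vertex) (l : List Φ), C.IsPath R v v l → C.Homotopic R v l []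

/-- Any two quadrilaterals of the region are linked by a chain of quadrilaterals of the region in
which consecutive ones are glued along a side. -/
def Connected (R : Finset C.Edge) : Prop :=
  ∀ e ∈ R, ∀ e' ∈ R,
    Relation.ReflTransGen (fun p q => ∃ x, C.edge x = p ∧ C.edge (C.a1 x) = q ∧ q ∈ R) e e'

/-- The side `x` of the region `R` lies on the boundary of `R`. -/
def IsBoundarySide (R : Finset C.Edge) (x : Φ) : Prop :=
  C.edge x ∈ R ∧ C.edge (C.a1 x) ∉ R

/-- The region is a closed disc: it is connected, simply connected, has a nonempty boundary, and its
boundary nowhere touches itself (at most two boundary sides end at any corner). -/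
structure IsDisc (R : Finset C.Edge) : Prop where
  connected : C.Connected R
  simplyConnected : C.SimplyConnected R
  boundary_nonempty : ∃ x, C.IsBoundarySide R x
  unpinched_vertex : ∀ v, Set.ncard {x | C.vertex x = v ∧ C.IsBoundarySide R x} ≤ 2
  unpinched_face : ∀ p, Set.ncard {x | C.face x = p ∧ C.IsBoundarySide R x} ≤ 2

end SurfaceLattice

/-! ### Qubits, partial trace and logarithmic negativity -/

/-- Operators on one qubit for each element of `E`, in the computational basis `E → Fin 2`. -/
abbrev QubitOp (E : Type*) := Matrix (E → Fin 2) (E → Fin 2) ℂ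

def sigmaX : Matrix (Fin 2) (Fin 2) ℂ := !![0, 1; 1, 0]

def sigmaZ : Matrix (Fin 2) (Fin 2) ℂ := !![1, 0; 0, -1]

/-- The tensor product of the one-qubit operators `M e`. -/
def tensorOp {E : Type*} [Fintype E] (M : E → Matrix (Fin 2) (Fin 2) ℂ) : QubitOp E :=
  Matrix.of fun s t => ∏ e, M e (s e) (t e)

/-- `ψ` is a normalised eigenvector of `H` for its lowest eigenvalue. -/
def IsGroundState {n : Type*} [Fintype n] (H : Matrix n n ℂ) (ψ : n → ℂ) : Prop :=
  ∑ s, ‖ψ s‖ ^ 2 = 1 ∧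
    ∃ E₀ : ℝ, H *ᵥ ψ = (E₀ : ℂ) • ψ ∧
      ∀ (E : ℝ) (φ : n → ℂ), φ ≠ 0 → H *ᵥ φ = (E : ℂ) • φ → E₀ ≤ E

/-- The projector `|ψ⟩⟨ψ|`. -/
def pureState {n : Type*} (ψ : n → ℂ) : Matrix n n ℂ := Matrix.vecMulVec ψ (star ψ)

/-- The configuration that is `a` on `P`, `b` on `Q` (for `Q` disjoint from `P`), and `c` elsewhere. -/
def glue {E : Type*} [DecidableEq E] (P Q : Finset E) (a : {e // e ∈ P} → Fin 2)
    (b : {e // e ∈ Q} → Fin 2) (c : {e // e ∉ P ∧ e ∉ Q} → Fin 2) : E → Fin 2 :=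
  fun e => if hP : e ∈ P then a ⟨e, hP⟩ else if hQ : e ∈ Q then b ⟨e, hQ⟩ else c ⟨e, hP, hQ⟩

/-- The reduced density matrix of `ρ` on the qubits of the disjoint regions `P` and `Q`: all the other
qubits are traced out. -/
def reducedState {E : Type*} [Fintype E] [DecidableEq E] (ρ : QubitOp E) (P Q : Finset E) :
    Matrix (({e // e ∈ P} → Fin 2) × ({e // e ∈ Q} → Fin 2))
      (({e // e ∈ P} → Fin 2) × ({e // e ∈ Q} → Fin 2)) ℂ :=
  Matrix.of fun x y =>
    ∑ c : {e // e ∉ P ∧ e ∉ Q} → Fin 2, ρ (glue P Q x.1 x.2 c) (glue P Q y.1 y.2 c)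

/-- The partial transpose with respect to the first factor. -/
def partialTranspose {m n : Type*} (ρ : Matrix (m × n) (m × n) ℂ) : Matrix (m × n) (m × n) ℂ :=
  Matrix.of fun x y => ρ (y.1, x.2) (x.1, y.2)

/-- `|M| = √(M† M)`. -/
def matrixAbs {n : Type*} [Fintype n] [DecidableEq n] (M : Matrix n n ℂ) : Matrix n n ℂ :=
  cfc Real.sqrt (Mᴴ * M)

/-- The logarithmic negativity `log₂ tr |ρ^{T_1}|` of a bipartite state `ρ`. -/
def logNegativity {m n : Type*} [Fintype m] [Fintype n] [DecidableEq m] [DecidableEq n]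
    (ρ : Matrix (m × n) (m × n) ℂ) : ℝ :=
  Real.logb 2 (matrixAbs (partialTranspose ρ)).trace.re

/-! ### The toric code -/

namespace SurfaceLattice

variable {Φ : Type*} [Finite Φ] (C : SurfaceLattice Φ)

/-- The star operator: the product of `σˣ` over the legs of `v`. -/
def starOp (v : C.Vertex) : QubitOp C.Edge := tensorOp fun e => sigmaX ^ C.legs v e

/-- The plaquette operator: the product of `σᶻ` along the boundary of `p`. -/
def plaquetteOp (p : C.Face) : QubitOp C.Edge := tensorOp fun e => sigmaZ ^ C.sides p e

/-- The toric code Hamiltonian with star terms at the vertices in `S` and plaquette terms at the faces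
in `P`. For a closed surface `S` and `P` contain everything; a face outside `P` is a hole of the
surface with a smooth boundary, a vertex outside `S` a hole with a rough boundary. -/
def hamiltonian (S : Finset C.Vertex) (P : Finset C.Face) (U J : ℝ) : QubitOp C.Edge :=
  -(U : ℂ) • ∑ v ∈ S, C.starOp v - (J : ℂ) • ∑ p ∈ P, C.plaquetteOp p

/-- The number of plaquettes that span the boundary between the regions `R` and `R'`. -/
def numSpanning (P : Finset C.Face) (R R' : Finset C.Edge) : ℕ :=
  Set.ncard {p | p ∈ P ∧ C.PlaquetteMeets p R ∧ C.PlaquetteMeets p R'}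

end SurfaceLattice

end

open scoped Matrix

noncomputable section

/-! Read configurations as functions from edges to the integers mod 2. A star operator translates by
the coboundary of a vertex; a plaquette operator measures the circulation round a face. The uniform
superposition of all coboundaries satisfies every term at once, so every ground state is invariant
under the stars in `S` and supported on configurations without circulation at the faces in `P`
(`IsGroundState.stabilized`).

A disc has no first cohomology mod 2 (`SimplyConnected.exists_potential`). By duality this gives two
exactness statements: a configuration closed at the faces inside `A` is a coboundary on `A`
(`IsDisc.exists_coboundary`), and one supported in `A` and closed everywhere is the coboundary of
interior weights (`IsDisc.exists_interior_coboundary`). Hence the freedom at the cut consists of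
weights on the boundary vertices up to a constant, normalised to 0 at one vertex `v₀`. With `n`
boundary vertices these are `2 ^ (n - 1)` labels, and they index the branches in `IsDisc.schmidt`.
Neither the topology outside `A` nor the choice of ground state matters.

Boundary stars do not act on `A₂` or `B₂`, so the branches differ by displacements of `A₁` and `B₁`
only, and they remain distinguishable after `A₂` and `B₂` are traced out. The reduced state is thus
a sum over pairs of labels of `u i (u j)ᴴ ⊗ w i (w j)ᴴ`, with Gram matrices that vanish off the
diagonal and are constant on it; its partial transpose has trace norm equal to the number of labels
(`logNegativity_sum_kronecker`). Finally, each boundary vertex and each spanning face carries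
exactly two boundary sides, so `n` is the number of spanning plaquettes. -/

/-! ### Linear algebra: solvability by duality -/

/-- Fredholm alternative for linear maps between finite coordinate spaces. -/
theorem exists_eq_of_forall_sum_mul_eq_zero {K ι κ : Type*} [Field K] [Fintype κ]
    (f : (ι → K) →ₗ[K] (κ → K)) (y : κ → K)
    (h : ∀ u : κ → K, (∀ r, ∑ k, u k * f r k = 0) → ∑ k, u k * y k = 0) :
    ∃ r, f r = y := by
  classical
  by_contra hy
  have hy' : y ∉ LinearMap.range f := fun ⟨r, hr⟩ => hy ⟨r, hr⟩
  obtain ⟨φ, hφy, hφ⟩ := Submodule.exists_le_ker_of_notMem hy'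
  have key : ∀ z : κ → K, ∑ k, φ (Pi.single k 1) * z k = φ z := by
    intro z
    conv_rhs => rw [← Finset.univ_sum_single z, map_sum]
    refine Finset.sum_congr rfl fun k _ => ?_
    rw [mul_comm, ← smul_eq_mul, ← map_smul, ← Pi.single_smul, smul_eq_mul, mul_one]
  refine hφy ?_
  rw [← key]
  refine h _ fun r => ?_
  rw [key]
  exact hφ ⟨r, rfl⟩

theorem ZMod.two_add_self (a : ZMod 2) : a + a = 0 := CharTwo.add_self_eq_zero a

theorem ZMod.two_eq_of_add_eq_zero {a b : ZMod 2} (h : a + b = 0) : a = b :=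
  CharTwo.add_eq_zero.mp h

/-- Solvability of `t x + t (σ x) = c x` on `R` by a function invariant under `τ`. -/
theorem exists_invariant_potential {Φ : Type*} [Fintype Φ] {σ τ : Φ → Φ}
    (hσ : Function.Involutive σ) (hτ : Function.Involutive τ) (R : Φ → Prop) (c : Φ → ZMod 2)
    (h : ∀ u : Φ → ZMod 2, (∀ x, ¬ R x → u x = 0) →
      (∀ x, u x + u (σ x) = u (τ x) + u (σ (τ x))) → ∑ x, u x * c x = 0) :
    ∃ t : Φ → ZMod 2, (∀ x, t (τ x) = t x) ∧ ∀ x, R x → t x + t (σ x) = c x := by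
  classical
  have reσ : ∀ g : Φ → ZMod 2, ∑ x, g (σ x) = ∑ x, g x := fun g =>
    Equiv.sum_comp (hσ.toPerm σ) g
  have reτ : ∀ g : Φ → ZMod 2, ∑ x, g (τ x) = ∑ x, g x := fun g =>
    Equiv.sum_comp (hτ.toPerm τ) g
  -- Invariance is built in by the ansatz `t = r + r ∘ τ` with `r` free; `f r` is then `t + t ∘ σ`,
  -- cut off to `R`.
  let f : (Φ → ZMod 2) →ₗ[ZMod 2] (Φ → ZMod 2) :=
    { toFun := fun r x => if R x then (r x + r (τ x)) + (r (σ x) + r (τ (σ x))) else 0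
      map_add' := by
        intro r r'; funext x
        by_cases hx : R x <;> simp [hx]; ring
      map_smul' := by
        intro a r; funext x
        by_cases hx : R x <;> simp [hx]; ring }
  have hf : ∀ r x, f r x = if R x then (r x + r (τ x)) + (r (σ x) + r (τ (σ x))) else 0 :=
    fun _ _ => rfl
  obtain ⟨r, hr⟩ := exists_eq_of_forall_sum_mul_eq_zero f (fun x => if R x then c x else 0) (by
    intro u hu
    let w : Φ → ZMod 2 := fun x => if R x then u x else 0
    have hw : ∀ g : Φ → ZMod 2, ∑ x, u x * (if R x then g x else 0) = ∑ x, w x * g x := by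
      intro g
      refine Finset.sum_congr rfl fun x _ => ?_
      by_cases hx : R x <;> simp [w, hx]
    rw [hw]
    refine h w (fun x hx => by simp [w, hx]) fun x => ?_
    have hsum : ∀ r : Φ → ZMod 2,
        ∑ x, ((w x + w (σ x)) + (w (τ x) + w (σ (τ x)))) * r x = 0 := by
      intro r
      have h1 := hu r
      simp only [hf] at h1
      rw [hw (fun x => (r x + r (τ x)) + (r (σ x) + r (τ (σ x))))] at h1
      rw [← h1]
      simp only [mul_add, add_mul, Finset.sum_add_distrib]
      -- Reindexing by `σ` and `τ` moves the operators from `r` onto `w`, that is, computes the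
      -- transpose of `f`.
      rw [← reτ (fun x => w (τ x) * r x), ← reσ (fun x => w (σ x) * r x),
        ← reτ (fun x => w (σ (τ x)) * r x), ← reσ (fun x => w (σ (τ (τ x))) * r (τ x))]
      simp only [hτ _, hσ _]
      ring
    have h2 := hsum (Pi.single x 1)
    simp only [Pi.single_apply, mul_ite, mul_one, mul_zero, Finset.sum_ite_eq', Finset.mem_univ,
      if_true] at h2
    exact ZMod.two_eq_of_add_eq_zero h2)
  refine ⟨fun x => r x + r (τ x), fun x => ?_, fun x hx => ?_⟩
  · simp only [hτ x]; ring
  · have := congrFun hr x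
    simpa [hf, hx] using this

/-! ### Flags, incidence numbers, coboundary and circulation mod 2 -/

namespace SurfaceLattice

variable {Φ : Type*} (C : SurfaceLattice Φ)

theorem vertex_a1 (x : Φ) : C.vertex (C.a1 x) = C.vertex x :=
  Eq.symm (Quot.sound (Or.inl rfl : C.a1 x = C.a1 x ∨ C.a1 x = C.a2 x))

theorem vertex_a2 (x : Φ) : C.vertex (C.a2 x) = C.vertex x :=
  Eq.symm (Quot.sound (Or.inr rfl : C.a2 x = C.a1 x ∨ C.a2 x = C.a2 x))

theorem edge_a0 (x : Φ) : C.edge (C.a0 x) = C.edge x :=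
  Eq.symm (Quot.sound (Or.inl rfl : C.a0 x = C.a0 x ∨ C.a0 x = C.a2 x))

theorem edge_a2 (x : Φ) : C.edge (C.a2 x) = C.edge x :=
  Eq.symm (Quot.sound (Or.inr rfl : C.a2 x = C.a0 x ∨ C.a2 x = C.a2 x))

theorem face_a0 (x : Φ) : C.face (C.a0 x) = C.face x :=
  Eq.symm (Quot.sound (Or.inl rfl : C.a0 x = C.a0 x ∨ C.a0 x = C.a1 x))

theorem face_a1 (x : Φ) : C.face (C.a1 x) = C.face x :=
  Eq.symm (Quot.sound (Or.inr rfl : C.a1 x = C.a0 x ∨ C.a1 x = C.a1 x))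

theorem vertex_surjective : Function.Surjective C.vertex := Quot.mk_surjective

theorem edge_surjective : Function.Surjective C.edge := Quot.mk_surjective

theorem face_surjective : Function.Surjective C.face := Quot.mk_surjective

/-- `a0` and `a2` are commuting involutions, so these four flags are already closed under both. -/
theorem edge_eq_iff {x y : Φ} :
    C.edge y = C.edge x ↔ y = x ∨ y = C.a0 x ∨ y = C.a2 x ∨ y = C.a0 (C.a2 x) := by
  constructor
  · intro h
    have h' := Quot.eqvGen_exact h.symm
    clear h
    induction h' with
    | rel a b hab => rcases hab with h | h <;> simp [h]
    | refl a => simp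
    | symm a b _ ih =>
      rcases ih with h | h | h | h <;> subst h <;>
        simp [C.a0_invol, C.a2_invol, C.a0_a2_comm]
    | trans a b c _ _ ih1 ih2 =>
      rcases ih1 with h | h | h | h <;> subst h <;> rcases ih2 with h | h | h | h <;> subst h <;>
        simp [C.a0_invol, C.a2_invol, C.a0_a2_comm]
  · rintro (h | h | h | h) <;> subst h <;> simp [edge_a0, edge_a2]

theorem a0_ne_a2 (x : Φ) : C.a0 x ≠ C.a2 x := fun h =>
  C.a0_a2_ne x (by rw [← h, C.a0_invol])

theorem sum_edge_fiber {M : Type*} [AddCommMonoid M] [Fintype Φ] [DecidableEq Φ] (u : Φ → M)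
    (x : Φ) : ∑ y with C.edge y = C.edge x, u y =
      u x + u (C.a0 x) + u (C.a2 x) + u (C.a0 (C.a2 x)) := by
  have : (Finset.univ.filter fun y => C.edge y = C.edge x) =
      {x, C.a0 x, C.a2 x, C.a0 (C.a2 x)} := by
    ext y; simp [edge_eq_iff]
  rw [this, Finset.sum_insert, Finset.sum_insert, Finset.sum_insert, Finset.sum_singleton]
  · simp only [add_assoc]
  · simpa using fun h => C.a0_ne _ h.symm
  · simp only [Finset.mem_insert, Finset.mem_singleton, not_or]
    refine ⟨C.a0_ne_a2 x, fun h => C.a2_ne x ?_⟩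
    rw [← C.a0_invol (C.a2 x), ← h, C.a0_invol]
  · simp only [Finset.mem_insert, Finset.mem_singleton, not_or]
    exact ⟨(C.a0_ne x).symm, (C.a2_ne x).symm, (C.a0_a2_ne x).symm⟩

/-- The four flags of an edge pair off under `a2`, which keeps the vertex; halving leaves one flag
for each end, and a loop counts twice. -/
theorem legs_edge [Finite Φ] (v : C.Vertex) (x : Φ) : C.legs v (C.edge x) =
    (if C.vertex x = v then 1 else 0) + (if C.vertex (C.a0 x) = v then 1 else 0) := by
  classical
  cases nonempty_fintype Φ
  have : Nat.card {y : Φ // C.vertex y = v ∧ C.edge y = C.edge x} =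
      ∑ y with C.edge y = C.edge x, if C.vertex y = v then 1 else 0 := by
    rw [Nat.card_eq_fintype_card, Fintype.card_subtype, Finset.card_filter, Finset.sum_filter]
    refine Finset.sum_congr rfl fun y _ => ?_
    by_cases h : C.edge y = C.edge x <;> simp [h]
  rw [legs, this, sum_edge_fiber, C.a0_a2_comm, C.vertex_a2, C.vertex_a2]
  split_ifs <;> rfl

theorem sides_edge [Finite Φ] (p : C.Face) (x : Φ) : C.sides p (C.edge x) =
    (if C.face x = p then 1 else 0) + (if C.face (C.a2 x) = p then 1 else 0) := by
  classical
  cases nonempty_fintype Φ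
  have : Nat.card {y : Φ // C.face y = p ∧ C.edge y = C.edge x} =
      ∑ y with C.edge y = C.edge x, if C.face y = p then 1 else 0 := by
    rw [Nat.card_eq_fintype_card, Fintype.card_subtype, Finset.card_filter, Finset.sum_filter]
    refine Finset.sum_congr rfl fun y _ => ?_
    by_cases h : C.edge y = C.edge x <;> simp [h]
  rw [sides, this, sum_edge_fiber, C.face_a0, C.face_a0]
  split_ifs <;> rfl

/-- The set of edges at which the operator `σˣ` occurs an odd number of times in the product of the
star operators with weights `f`. -/
def coboundary [Finite Φ] (f : C.Vertex → ZMod 2) (e : C.Edge) : ZMod 2 :=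
  ∑ v, f v * (C.legs v e : ZMod 2)

/-- The sum, modulo 2, of the values of `s` along the boundary of the face `p`. -/
def circulation [Finite Φ] (s : C.Edge → ZMod 2) (p : C.Face) : ZMod 2 :=
  ∑ e, s e * (C.sides p e : ZMod 2)

theorem coboundary_edge [Finite Φ] (f : C.Vertex → ZMod 2) (x : Φ) :
    C.coboundary f (C.edge x) = f (C.vertex x) + f (C.vertex (C.a0 x)) := by
  simp [coboundary, legs_edge, mul_add, Finset.sum_add_distrib]

theorem sum_mul_sides_edge [Finite Φ] (g : C.Face → ZMod 2) (x : Φ) :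
    ∑ p, g p * (C.sides p (C.edge x) : ZMod 2) = g (C.face x) + g (C.face (C.a2 x)) := by
  simp [sides_edge, mul_add, Finset.sum_add_distrib]

theorem coboundary_add [Finite Φ] (f g : C.Vertex → ZMod 2) :
    C.coboundary (f + g) = C.coboundary f + C.coboundary g := by
  funext e; simp [coboundary, add_mul, Finset.sum_add_distrib]

theorem circulation_add [Finite Φ] (s s' : C.Edge → ZMod 2) :
    C.circulation (s + s') = C.circulation s + C.circulation s' := by
  funext p; simp [circulation, add_mul, Finset.sum_add_distrib]

theorem circulation_zero [Finite Φ] : C.circulation 0 = 0 := by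
  funext p; simp [circulation]

/-- A sum over all flags of a function that depends on the edge only through a weight. -/
theorem sum_mul_edge [Fintype Φ] (u : Φ → ZMod 2) (s : C.Edge → ZMod 2) :
    ∑ x, u x * s (C.edge x) = ∑ e, s e * ∑ x with C.edge x = e, u x := by
  rw [← Finset.sum_fiberwise Finset.univ C.edge]
  refine Finset.sum_congr rfl fun e _ => ?_
  rw [Finset.mul_sum]
  refine Finset.sum_congr rfl fun x hx => ?_
  rw [(Finset.mem_filter.mp hx).2, mul_comm]

/-- Star and plaquette operators commute. -/
theorem circulation_coboundary [Finite Φ] (f : C.Vertex → ZMod 2) (p : C.Face) :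
    C.circulation (C.coboundary f) p = 0 := by
  classical
  cases nonempty_fintype Φ
  have h : C.circulation (C.coboundary f) p =
      ∑ x : Φ, if C.face x = p then f (C.vertex x) else 0 := by
    rw [← Finset.sum_fiberwise Finset.univ C.edge, circulation]
    refine Finset.sum_congr rfl fun e _ => ?_
    obtain ⟨x, rfl⟩ := C.edge_surjective e
    rw [sum_edge_fiber, coboundary_edge, sides_edge, C.face_a0, C.face_a0, C.a0_a2_comm,
      C.vertex_a2, C.vertex_a2]
    split_ifs <;> push_cast <;> ring
  rw [h]
  -- The flags of a face cancel in pairs at its corners: `a1` fixes both the face and the vertex and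
  -- has no fixed flag.
  refine Finset.sum_involution (fun x _ => C.a1 x) ?_ ?_ ?_ ?_
  · intro x _
    rw [C.face_a1, C.vertex_a1]
    exact ZMod.two_add_self _
  · intro x _ _; exact C.a1_ne x
  · intro x _; exact Finset.mem_univ _
  · intro x _; exact C.a1_invol x

/-- A function on flags that is unchanged by `a0` and `a1` descends to faces. -/
theorem exists_eq_face (w : Φ → ZMod 2) (h0 : ∀ x, w (C.a0 x) = w x) (h1 : ∀ x, w (C.a1 x) = w x) :
    ∃ g : C.Face → ZMod 2, ∀ x, w x = g (C.face x) :=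
  ⟨Quot.lift w (by rintro x y (h | h) <;> subst h <;> simp [h0, h1]), fun _ => rfl⟩

/-- A function on flags that is unchanged by `a1` and `a2` descends to vertices. -/
theorem exists_eq_vertex (w : Φ → ZMod 2) (h1 : ∀ x, w (C.a1 x) = w x)
    (h2 : ∀ x, w (C.a2 x) = w x) : ∃ g : C.Vertex → ZMod 2, ∀ x, w x = g (C.vertex x) :=
  ⟨Quot.lift w (by rintro x y (h | h) <;> subst h <;> simp [h1, h2]), fun _ => rfl⟩

/-! ### Paths and mod 2 cohomology of a disc -/

variable {C} in
theorem IsPath.edge_mem {R : Finset C.Edge} {v w : C.Vertex} {l : List Φ} (h : C.IsPath R v w l) :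
    ∀ x ∈ l, C.edge x ∈ R := by
  induction h with
  | nil => simp
  | cons x y w l hx hy _ _ ih =>
    intro z hz
    rcases List.mem_cons.mp hz with rfl | hz
    · exact hx
    rcases List.mem_cons.mp hz with rfl | hz
    · exact hy
    exact ih z hz

variable {C} in
theorem IsPath.append {R : Finset C.Edge} {u v w : C.Vertex} {l m : List Φ}
    (h : C.IsPath R u v l) (h' : C.IsPath R v w m) : C.IsPath R u w (l ++ m) := by
  induction h with
  | nil => exact h'
  | cons x y w l hx hy hxy _ ih => exact IsPath.cons x y _ _ hx hy hxy (ih h')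

variable {C} in
theorem IsPath.reverse {R : Finset C.Edge} {v w : C.Vertex} {l : List Φ}
    (h : C.IsPath R v w l) : C.IsPath R w v l.reverse := by
  induction h with
  | nil => exact IsPath.nil _
  | cons x y w l hx hy hxy _ ih =>
    have := ih.append (IsPath.cons y x _ _ hy hx hxy.symm (IsPath.nil _))
    simpa using this

variable {C} in
/-- A cocycle sums to zero along every closed path of a simply connected region. -/
theorem SimplyConnected.sum_eq_zero {R : Finset C.Edge} (h : C.SimplyConnected R) {t : Φ → ZMod 2}
    (h1 : ∀ x, t (C.a1 x) = t x)
    (hsq : ∀ x, C.edge x ∈ R → t x + t (C.a0 x) = t (C.a2 x) + t (C.a2 (C.a0 x)))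
    {v : C.Vertex} {l : List Φ} (hl : C.IsPath R v v l) : (l.map t).sum = 0 := by
  have key : ∀ l m, C.Homotopic R v l m → (l.map t).sum = (m.map t).sum := by
    intro l m hlm
    induction hlm with
    | refl => rfl
    | symm _ _ _ ih => exact ih.symm
    | trans _ _ _ _ _ ih ih' => exact ih.trans ih'
    | rel l m h =>
      obtain ⟨hl, -, hm⟩ := h
      cases hm with
      | side l r x => simp [h1]
      | backtrack l r x =>
        simp only [List.map_append, List.map_cons, List.sum_append, List.sum_cons]
        rw [← add_assoc (t x), ZMod.two_add_self, zero_add]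
      | square l r x _ =>
        have := hsq x (hl.edge_mem x (by simp))
        simp only [List.map_append, List.map_cons, List.sum_append, List.sum_cons]
        rw [← add_assoc (t x), this, add_assoc]
  simpa using key l [] (h v l hl)

-- Glued quadrilaterals share a side and hence its vertex; inside one quadrilateral the two vertices
-- are joined by a path of two sides through a face corner.
variable {C} in
theorem Connected.exists_isPath {R : Finset C.Edge} (h : C.Connected R) {x y : Φ}
    (hx : C.edge x ∈ R) (hy : C.edge y ∈ R) : ∃ l, C.IsPath R (C.vertex x) (C.vertex y) l := by
  have same : ∀ a b : Φ, C.edge a = C.edge b → C.edge b ∈ R →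
      ∃ l, C.IsPath R (C.vertex b) (C.vertex a) l := by
    intro a b hab hb
    have step : ∃ l, C.IsPath R (C.vertex b) (C.vertex (C.a0 b)) l :=
      ⟨_, IsPath.cons b (C.a0 b) _ _ hb (by rwa [C.edge_a0]) (C.face_a0 b).symm (IsPath.nil _)⟩
    rcases C.edge_eq_iff.mp hab with h | h | h | h <;> subst h
    · exact ⟨[], IsPath.nil _⟩
    · exact step
    · rw [C.vertex_a2]; exact ⟨[], IsPath.nil _⟩
    · rw [C.a0_a2_comm, C.vertex_a2]; exact step
  have key : ∀ e, Relation.ReflTransGen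
      (fun p q => ∃ x, C.edge x = p ∧ C.edge (C.a1 x) = q ∧ q ∈ R) (C.edge x) e →
      e ∈ R ∧ ∀ z, C.edge z = e → ∃ l, C.IsPath R (C.vertex x) (C.vertex z) l := by
    intro e he
    induction he with
    | refl => exact ⟨hx, fun z hz => same z x hz hx⟩
    | tail _ hstep ih =>
      obtain ⟨y, rfl, rfl, hq⟩ := hstep
      refine ⟨hq, fun z hz => ?_⟩
      obtain ⟨l, hl⟩ := ih.2 y rfl
      obtain ⟨m, hm⟩ := same z (C.a1 y) hz hq
      rw [C.vertex_a1] at hm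
      exact ⟨_, hl.append hm⟩
  exact (key _ (h _ hx _ hy)).2 y rfl

variable {C} in
/-- On a connected and simply connected region every cocycle is a coboundary. -/
theorem SimplyConnected.exists_potential {R : Finset C.Edge} (h : C.SimplyConnected R)
    (hc : C.Connected R) {t : Φ → ZMod 2} (h1 : ∀ x, t (C.a1 x) = t x)
    (hsq : ∀ x, C.edge x ∈ R → t x + t (C.a0 x) = t (C.a2 x) + t (C.a2 (C.a0 x))) :
    ∃ (f : C.Vertex → ZMod 2) (g : C.Face → ZMod 2),
      ∀ x, C.edge x ∈ R → t x = f (C.vertex x) + g (C.face x) := by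
  classical
  by_cases hne : ∃ x, C.edge x ∈ R
  swap
  · exact ⟨0, 0, fun x hx => (hne ⟨x, hx⟩).elim⟩
  obtain ⟨x₀, hx₀⟩ := hne
  -- Integrate `t` along any path from the base vertex. The result is path independent since closed
  -- paths sum to zero; the default 0 at unreachable vertices is never used.
  let f : C.Vertex → ZMod 2 := fun v =>
    if hv : ∃ l, C.IsPath R (C.vertex x₀) v l then (hv.choose.map t).sum else 0
  have hf : ∀ v l, C.IsPath R (C.vertex x₀) v l → f v = (l.map t).sum := by
    intro v l hl
    have hv : ∃ l, C.IsPath R (C.vertex x₀) v l := ⟨l, hl⟩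
    have := h.sum_eq_zero h1 hsq (hv.choose_spec.append hl.reverse)
    simp only [List.map_append, List.map_reverse, List.sum_append, List.sum_reverse] at this
    simp only [f, dif_pos hv]
    exact ZMod.two_eq_of_add_eq_zero this
  -- One side `y` at the face fixes the value of `g`; any other side `x` there is compared by
  -- prolonging the path to `y` by `y, x`.
  let g : C.Face → ZMod 2 := fun p =>
    if hp : ∃ y, C.face y = p ∧ C.edge y ∈ R then t hp.choose + f (C.vertex hp.choose) else 0
  refine ⟨f, g, fun x hx => ?_⟩
  have hp : ∃ y, C.face y = C.face x ∧ C.edge y ∈ R := ⟨x, rfl, hx⟩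
  have hg : g (C.face x) = t hp.choose + f (C.vertex hp.choose) := dif_pos hp
  obtain ⟨hy1, hy2⟩ := hp.choose_spec
  set y := hp.choose
  obtain ⟨l, hl⟩ := hc.exists_isPath hx₀ hy2
  have e1 := hf _ _ hl
  have e2 := hf _ _ (hl.append (IsPath.cons y x _ _ hy2 hx hy1 (IsPath.nil _)))
  simp only [List.map_append, List.map_cons, List.map_nil, List.sum_append, List.sum_cons,
    List.sum_nil] at e2
  rw [hg, e2, e1]
  have h2 := ZMod.two_add_self (t y)
  have h3 := ZMod.two_add_self (l.map t).sum
  linear_combination -h2 - h3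

variable {C} in
/-- A configuration satisfying all plaquettes inside a disc is a product of stars there. -/
theorem IsDisc.exists_coboundary [Finite Φ] {A : Finset C.Edge} (hA : C.IsDisc A)
    {s : C.Edge → ZMod 2}
    (hs : ∀ p, ¬ C.PlaquetteMeets p Aᶜ → C.circulation s p = 0) :
    ∃ f : C.Vertex → ZMod 2, ∀ e ∈ A, s e = C.coboundary f e := by
  classical
  cases nonempty_fintype Φ
  -- Lift `s` to a function `t` on glued sides, with `s` the sum of `t` over two sides meeting at a
  -- face. Writing `t` as vertex part plus face part, the face part cancels and the vertex part is
  -- the wanted weight.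
  obtain ⟨t, ht1, ht⟩ := exists_invariant_potential (σ := C.a0) (τ := C.a1) C.a0_invol C.a1_invol
    (fun x => C.edge x ∈ A) (fun x => s (C.edge x)) (by
      intro u hu hinv
      -- An obstruction `u` yields a weight `g` on faces and pairs with `s` to a weighted sum of
      -- circulations. Faces reaching outside `A` get weight 0, because `u` vanishes off `A`; the
      -- others have circulation 0.
      obtain ⟨g, hg⟩ := C.exists_eq_face (fun x => u x + u (C.a0 x))
        (fun x => by simp only [C.a0_invol]; ring) (fun x => (hinv x).symm)
      rw [C.sum_mul_edge]
      have : ∀ e, s e * ∑ x with C.edge x = e, u x =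
          ∑ p, g p * (s e * (C.sides p e : ZMod 2)) := by
        intro e
        obtain ⟨x, rfl⟩ := C.edge_surjective e
        have h2 := hg (C.a2 x)
        have h0 := hg x
        simp_rw [mul_left_comm (g _)]
        rw [C.sum_edge_fiber, ← Finset.mul_sum, C.sum_mul_sides_edge, ← h2, ← h0]
        ring
      simp_rw [this]
      rw [Finset.sum_comm]
      refine Finset.sum_eq_zero fun p _ => ?_
      rw [← Finset.mul_sum]
      by_cases hp : C.PlaquetteMeets p Aᶜ
      · obtain ⟨x, rfl, hx⟩ := hp
        rw [Finset.mem_compl] at hx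
        rw [← hg, hu x hx, hu (C.a0 x) (by rwa [C.edge_a0])]
        simp
      · have := hs p hp
        rw [circulation] at this
        rw [this, mul_zero])
  obtain ⟨f, g, hfg⟩ := hA.simplyConnected.exists_potential hA.connected ht1 (by
    intro x hx
    rw [ht x hx, ← C.a0_a2_comm, ht (C.a2 x) (by rwa [C.edge_a2]), C.edge_a2])
  refine ⟨f, fun e he => ?_⟩
  obtain ⟨x, rfl⟩ := C.edge_surjective e
  rw [coboundary_edge, ← ht x he, hfg x he, hfg (C.a0 x) (by rwa [C.edge_a0]), C.face_a0]
  have := ZMod.two_add_self (g (C.face x))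
  linear_combination this

variable {C} in
/-- A set of edges of a disc meeting every interior star evenly is a product of plaquettes there. -/
theorem IsDisc.exists_sum_sides [Finite Φ] {A : Finset C.Edge} (hA : C.IsDisc A)
    {c : C.Edge → ZMod 2}
    (hc : ∀ v, ¬ C.StarMeets v Aᶜ → ∑ e, c e * (C.legs v e : ZMod 2) = 0) :
    ∃ g : C.Face → ZMod 2, ∀ e ∈ A, c e = ∑ p, g p * (C.sides p e : ZMod 2) := by
  classical
  cases nonempty_fintype Φ
  -- The dual argument, with vertices and faces exchanged: now the vertex part of `t` cancels and
  -- the face part remains.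
  obtain ⟨t, ht1, ht⟩ := exists_invariant_potential (σ := C.a2) (τ := C.a1) C.a2_invol C.a1_invol
    (fun x => C.edge x ∈ A) (fun x => c (C.edge x)) (by
      intro u hu hinv
      obtain ⟨g, hg⟩ := C.exists_eq_vertex (fun x => u x + u (C.a2 x)) (fun x => (hinv x).symm)
        (fun x => by simp only [C.a2_invol]; ring)
      rw [C.sum_mul_edge]
      have : ∀ e, c e * ∑ x with C.edge x = e, u x =
          ∑ v, g v * (c e * (C.legs v e : ZMod 2)) := by
        intro e
        obtain ⟨x, rfl⟩ := C.edge_surjective e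
        have h2 := hg (C.a0 x)
        have h0 := hg x
        have h3 := C.coboundary_edge g x
        rw [coboundary] at h3
        simp_rw [mul_left_comm (g _)]
        rw [C.sum_edge_fiber, ← Finset.mul_sum, h3, ← h2, ← h0, C.a0_a2_comm]
        ring
      simp_rw [this]
      rw [Finset.sum_comm]
      refine Finset.sum_eq_zero fun v _ => ?_
      rw [← Finset.mul_sum]
      by_cases hv : C.StarMeets v Aᶜ
      · obtain ⟨x, rfl, hx⟩ := hv
        rw [Finset.mem_compl] at hx
        rw [← hg, hu x hx, hu (C.a2 x) (by rwa [C.edge_a2])]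
        simp
      · rw [hc v hv, mul_zero])
  obtain ⟨f, g, hfg⟩ := hA.simplyConnected.exists_potential hA.connected ht1 (by
    intro x hx
    have h1 := ht x hx
    have h2 := ht (C.a0 x) (by rwa [C.edge_a0])
    rw [C.edge_a0, ← h1] at h2
    have e1 := ZMod.two_add_self (t (C.a2 x))
    have e2 := ZMod.two_add_self (t (C.a0 x))
    linear_combination e2 - h2 - e1)
  refine ⟨g, fun e he => ?_⟩
  obtain ⟨x, rfl⟩ := C.edge_surjective e
  rw [sum_mul_sides_edge, ← ht x he, hfg x he, hfg (C.a2 x) (by rwa [C.edge_a2]), C.vertex_a2]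
  have := ZMod.two_add_self (f (C.vertex x))
  linear_combination this

variable {C} in
/-- A configuration in a disc satisfying all plaquettes is a product of interior stars. -/
theorem IsDisc.exists_interior_coboundary [Finite Φ] {A : Finset C.Edge} (hA : C.IsDisc A)
    {s : C.Edge → ZMod 2} (hsA : ∀ e ∉ A, s e = 0) (hs : ∀ p, C.circulation s p = 0) :
    ∃ f : C.Vertex → ZMod 2, (∀ v, C.StarMeets v Aᶜ → f v = 0) ∧ s = C.coboundary f := by
  classical
  let L : (C.Vertex → ZMod 2) →ₗ[ZMod 2] (C.Edge → ZMod 2) :=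
    { toFun := fun f => C.coboundary fun v => if C.StarMeets v Aᶜ then 0 else f v
      map_add' := by
        intro f g
        rw [← coboundary_add]; congr 1; funext v
        by_cases h : C.StarMeets v Aᶜ <;> simp [h]
      map_smul' := by
        intro a f
        funext e
        simp only [coboundary, Pi.smul_apply, smul_eq_mul, Finset.mul_sum, RingHom.id_apply]
        refine Finset.sum_congr rfl fun v _ => ?_
        by_cases h : C.StarMeets v Aᶜ <;> simp [h, mul_assoc] }
  have hL : ∀ f, L f = C.coboundary fun v => if C.StarMeets v Aᶜ then 0 else f v := fun _ => rfl
  -- A functional `c` killing all interior stars is a sum of plaquettes on `A`, so it pairs with `s`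
  -- to a combination of circulations, which vanish.
  obtain ⟨f, hf⟩ := exists_eq_of_forall_sum_mul_eq_zero L s (by
    intro c hc
    obtain ⟨g, hg⟩ := hA.exists_sum_sides (c := c) (by
      intro v hv
      rw [← hc (Pi.single v 1), hL]
      refine Finset.sum_congr rfl fun e _ => ?_
      rw [coboundary, Finset.sum_eq_single v]
      · simp [hv]
      · intro w _ hw; simp [hw]
      · simp)
    have : ∀ e, c e * s e = ∑ p, g p * (s e * (C.sides p e : ZMod 2)) := by
      intro e
      by_cases he : e ∈ A
      · simp_rw [mul_left_comm (g _)]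
        rw [hg e he, ← Finset.mul_sum, mul_comm]
      · simp [hsA e he]
    simp_rw [this]
    rw [Finset.sum_comm]
    refine Finset.sum_eq_zero fun p _ => ?_
    rw [← Finset.mul_sum]
    have := hs p
    rw [circulation] at this
    rw [this, mul_zero])
  exact ⟨_, fun v hv => by simp [hv], hf.symm⟩

variable {C} in
/-- A vertex function with vanishing coboundary is constant on a connected region. -/
theorem Connected.eq_of_coboundary_eq_zero [Finite Φ] {R : Finset C.Edge} (h : C.Connected R)
    {f : C.Vertex → ZMod 2} (hf : ∀ e ∈ R, C.coboundary f e = 0) {v w : C.Vertex}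
    (hv : C.StarMeets v R) (hw : C.StarMeets w R) : f v = f w := by
  obtain ⟨x, rfl, hx⟩ := hv
  obtain ⟨y, rfl, hy⟩ := hw
  obtain ⟨l, hl⟩ := h.exists_isPath hx hy
  have step : ∀ z, C.edge z ∈ R → ∀ z', C.edge z' = C.edge z → f (C.vertex z') = f (C.vertex z) := by
    intro z hz z' hz'
    have := hf _ hz
    rw [coboundary_edge] at this
    have := ZMod.two_eq_of_add_eq_zero this
    rcases C.edge_eq_iff.mp hz' with h | h | h | h <;> subst h <;>
      simp [C.a0_a2_comm, C.vertex_a2, this]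
  have key : ∀ e, Relation.ReflTransGen
      (fun p q => ∃ x, C.edge x = p ∧ C.edge (C.a1 x) = q ∧ q ∈ R) (C.edge x) e →
      e ∈ R ∧ ∀ z, C.edge z = e → f (C.vertex z) = f (C.vertex x) := by
    intro e he
    induction he with
    | refl => exact ⟨hx, fun z hz => step x hx z hz⟩
    | tail _ hstep ih =>
      obtain ⟨y, rfl, rfl, hq⟩ := hstep
      refine ⟨hq, fun z hz => ?_⟩
      rw [step _ hq z hz, C.vertex_a1, ih.2 y rfl]
  exact ((key _ (h _ hx _ hy)).2 y rfl).symm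

/-! ### Counting along the boundary circle -/

/-- An element of `Φ` moved out of an invariant-by-`σ` set by `τ`, in a class generated by `σ, τ`. -/
theorem exists_mem_not_mem {α : Type*} {r : Φ → Φ → Prop} {q : Set Φ} (f : Φ → α)
    (hr : ∀ x y, f x = f y → Relation.EqvGen r x y) (hrf : ∀ x y, r x y → f x = f y)
    {x y : Φ} (hxy : f x = f y) (hx : x ∈ q) (hy : y ∉ q) :
    ∃ a b, f a = f x ∧ a ∈ q ∧ b ∉ q ∧ (r a b ∨ r b a) := by
  -- Along a chain of elementary steps from `x` to `y`, membership in `q` has to change at some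
  -- step.
  have key : ∀ x y, Relation.EqvGen r x y → f x = f y ∧
      ((x ∈ q ↔ y ∈ q) ∨ ∃ a b, f a = f x ∧ a ∈ q ∧ b ∉ q ∧ (r a b ∨ r b a)) := by
    intro x y h
    induction h with
    | rel a b h =>
      refine ⟨hrf _ _ h, ?_⟩
      by_cases ha : a ∈ q <;> by_cases hb : b ∈ q
      · exact Or.inl (by tauto)
      · exact Or.inr ⟨a, b, rfl, ha, hb, Or.inl h⟩
      · exact Or.inr ⟨b, a, (hrf _ _ h).symm, hb, ha, Or.inr h⟩
      · exact Or.inl (by tauto)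
    | refl => exact ⟨rfl, Or.inl Iff.rfl⟩
    | symm a b _ ih =>
      refine ⟨ih.1.symm, ih.2.imp Iff.symm ?_⟩
      rintro ⟨c, d, h1, h2⟩; exact ⟨c, d, h1.trans ih.1, h2⟩
    | trans a b c _ _ ih1 ih2 =>
      refine ⟨ih1.1.trans ih2.1, ?_⟩
      rcases ih1.2 with h | h
      · rcases ih2.2 with h' | ⟨d, d', h1, h2⟩
        · exact Or.inl (h.trans h')
        · exact Or.inr ⟨d, d', h1.trans ih1.1.symm, h2⟩
      · exact Or.inr h
  rcases (key x y (hr x y hxy)).2 with h | h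
  · exact (hy (h.mp hx)).elim
  · exact h

/-- In a class of flags stable under `σ` and `τ`, the number of sides by which `τ` leaves the
`σ`-stable set `q` is even. -/
theorem even_card_leaving [Fintype Φ] [DecidableEq Φ] {σ τ : Φ → Φ} (hσ : Function.Involutive σ)
    (hτ : Function.Involutive τ) (hσne : ∀ x, σ x ≠ x) (hτne : ∀ x, τ x ≠ x) (k q : Φ → Prop)
    [DecidablePred k] [DecidablePred q] (hk : ∀ x, k (σ x) ↔ k x) (hk' : ∀ x, k (τ x) ↔ k x)
    (hq : ∀ x, q (σ x) ↔ q x) :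
    Even (Finset.univ.filter fun x => k x ∧ q x ∧ ¬ q (τ x)).card := by
  -- Modulo 2, `σ` pairs off everything in `q`, and `τ` pairs off what it keeps inside `q`; the rest
  -- is what leaves.
  have e1 : ((Finset.univ.filter fun x => k x ∧ q x).card : ZMod 2) = 0 := by
    rw [Finset.card_eq_sum_ones, Nat.cast_sum]
    refine Finset.sum_involution (fun x _ => σ x) ?_ ?_ ?_ ?_
    · intro x _; decide
    · intro x _ _; exact hσne x
    · intro x hx; simpa [hk, hq] using hx
    · intro x _; exact hσ x
  have e2 : ((Finset.univ.filter fun x => k x ∧ q x ∧ q (τ x)).card : ZMod 2) = 0 := by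
    rw [Finset.card_eq_sum_ones, Nat.cast_sum]
    refine Finset.sum_involution (fun x _ => τ x) ?_ ?_ ?_ ?_
    · intro x _; decide
    · intro x _ _; exact hτne x
    · intro x hx
      simp only [Finset.mem_filter, Finset.mem_univ, true_and] at hx ⊢
      exact ⟨(hk' x).mpr hx.1, hx.2.2, by rw [hτ]; exact hx.2.1⟩
    · intro x _; exact hτ x
  have e3 := Finset.card_filter_add_card_filter_not (s := Finset.univ.filter fun x => k x ∧ q x)
    (fun x => q (τ x))
  simp only [Finset.filter_filter, and_assoc] at e3
  rw [← ZMod.natCast_eq_zero_iff_even]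
  rw [← e3, Nat.cast_add, e2, zero_add] at e1
  exact e1

-- Walking round the face from `A` to its complement crosses the boundary at least once, the number
-- of crossings is even, and the unpinched condition allows at most two.
variable {C} in
theorem IsDisc.ncard_boundary_face [Finite Φ] {A : Finset C.Edge} (hA : C.IsDisc A) (p : C.Face)
    (hp : C.PlaquetteMeets p A) (hp' : C.PlaquetteMeets p Aᶜ) :
    Set.ncard {x | C.face x = p ∧ C.IsBoundarySide A x} = 2 := by
  classical
  cases nonempty_fintype Φ
  have hle := hA.unpinched_face p
  have heven : Even (Set.ncard {x | C.face x = p ∧ C.IsBoundarySide A x}) := by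
    rw [Set.ncard_eq_toFinset_card', Set.toFinset_ofPred]
    convert even_card_leaving C.a0_invol C.a1_invol C.a0_ne C.a1_ne (fun x => C.face x = p)
      (fun x => C.edge x ∈ A) (fun x => by rw [C.face_a0]) (fun x => by rw [C.face_a1])
      (fun x => by rw [C.edge_a0])
    rfl
  have hpos : 0 < Set.ncard {x | C.face x = p ∧ C.IsBoundarySide A x} := by
    obtain ⟨x, hx, hxA⟩ := hp
    obtain ⟨y, hy, hyA⟩ := hp'
    obtain ⟨a, b, h1, h2, h3, h4⟩ := exists_mem_not_mem (q := {x | C.edge x ∈ A}) C.face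
      (fun x y h => Quot.eqvGen_exact h) (fun x y h => Quot.sound h) (hx.trans hy.symm) hxA
      (Finset.mem_compl.mp hyA)
    rw [Set.ncard_pos]
    refine ⟨a, h1.trans hx, h2, ?_⟩
    simp only [Set.mem_ofPred_eq] at h2 h3
    rcases h4 with (rfl | rfl) | (rfl | rfl)
    · exact (h3 (by rwa [C.edge_a0])).elim
    · exact h3
    · exact (h3 (by rwa [C.edge_a0] at h2)).elim
    · rwa [C.a1_invol]
  obtain ⟨k, hk⟩ := heven
  omega

variable {C} in
theorem IsDisc.ncard_boundary_vertex [Finite Φ] {A : Finset C.Edge} (hA : C.IsDisc A)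
    (v : C.Vertex) (hv : C.StarMeets v A) (hv' : C.StarMeets v Aᶜ) :
    Set.ncard {x | C.vertex x = v ∧ C.IsBoundarySide A x} = 2 := by
  classical
  cases nonempty_fintype Φ
  have hle := hA.unpinched_vertex v
  have heven : Even (Set.ncard {x | C.vertex x = v ∧ C.IsBoundarySide A x}) := by
    rw [Set.ncard_eq_toFinset_card', Set.toFinset_ofPred]
    convert even_card_leaving C.a2_invol C.a1_invol C.a2_ne C.a1_ne (fun x => C.vertex x = v)
      (fun x => C.edge x ∈ A) (fun x => by rw [C.vertex_a2]) (fun x => by rw [C.vertex_a1])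
      (fun x => by rw [C.edge_a2])
    rfl
  have hpos : 0 < Set.ncard {x | C.vertex x = v ∧ C.IsBoundarySide A x} := by
    obtain ⟨x, hx, hxA⟩ := hv
    obtain ⟨y, hy, hyA⟩ := hv'
    obtain ⟨a, b, h1, h2, h3, h4⟩ := exists_mem_not_mem (q := {x | C.edge x ∈ A}) C.vertex
      (fun x y h => Quot.eqvGen_exact h) (fun x y h => Quot.sound h) (hx.trans hy.symm) hxA
      (Finset.mem_compl.mp hyA)
    rw [Set.ncard_pos]
    refine ⟨a, h1.trans hx, h2, ?_⟩
    simp only [Set.mem_ofPred_eq] at h2 h3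
    rcases h4 with (rfl | rfl) | (rfl | rfl)
    · exact h3
    · exact (h3 (by rwa [C.edge_a2])).elim
    · rwa [C.a1_invol]
    · exact (h3 (by rwa [C.edge_a2] at h2)).elim
  obtain ⟨k, hk⟩ := heven
  omega

theorem _root_.Set.ncard_eq_mul_two {α β : Type*} [Finite α] [Finite β] {s : Set α} {t : Set β}
    {f : α → β} (h : Set.MapsTo f s t) (h2 : ∀ b ∈ t, Set.ncard {a | f a = b ∧ a ∈ s} = 2) :
    s.ncard = t.ncard * 2 := by
  classical
  cases nonempty_fintype α
  cases nonempty_fintype β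
  rw [Set.ncard_eq_toFinset_card', Set.ncard_eq_toFinset_card',
    Finset.card_eq_sum_card_fiberwise (f := f) (t := t.toFinset) (by simpa using h)]
  refine Finset.sum_const_nat fun b hb => ?_
  rw [← h2 b (by simpa using hb), Set.ncard_eq_toFinset_card']
  congr 1
  ext a
  simp [and_comm]

variable {C} in
/-- The boundary circle of a disc passes through as many vertices as faces. -/
theorem IsDisc.ncard_boundary_vertices_eq [Finite Φ] {A : Finset C.Edge} (hA : C.IsDisc A) :
    Set.ncard {v | C.StarMeets v A ∧ C.StarMeets v Aᶜ} =
      Set.ncard {p | C.PlaquetteMeets p A ∧ C.PlaquetteMeets p Aᶜ} := by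
  -- Count the boundary sides twice, by their vertex ends and by their face ends.
  have hV := Set.ncard_eq_mul_two (s := {x | C.IsBoundarySide A x})
    (t := {v | C.StarMeets v A ∧ C.StarMeets v Aᶜ}) (f := C.vertex)
    (fun x hx => ⟨⟨x, rfl, hx.1⟩, C.a1 x, C.vertex_a1 x, Finset.mem_compl.mpr hx.2⟩)
    fun v hv => hA.ncard_boundary_vertex v hv.1 hv.2
  have hF := Set.ncard_eq_mul_two (s := {x | C.IsBoundarySide A x})
    (t := {p | C.PlaquetteMeets p A ∧ C.PlaquetteMeets p Aᶜ}) (f := C.face)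
    (fun x hx => ⟨⟨x, rfl, hx.1⟩, C.a1 x, C.face_a1 x, Finset.mem_compl.mpr hx.2⟩)
    fun p hp => hA.ncard_boundary_face p hp.1 hp.2
  omega

end SurfaceLattice

/-! ### Negativity of a superposition of distinguishable branches -/

open scoped Kronecker ComplexOrder

/-- The spectrum of `Q` is nonnegative, so the square root of its square is `Q` itself. This allows
the absolute value to be guessed and then verified. -/
theorem matrixAbs_eq_of_posSemidef {n : Type*} [Fintype n] [DecidableEq n] {X Q : Matrix n n ℂ}
    (hQ : Q.PosSemidef) (h : Xᴴ * X = Q * Q) : matrixAbs X = Q := by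
  rw [matrixAbs, h]
  have hsa : IsSelfAdjoint Q := hQ.isHermitian
  have h2 : Q * Q = cfc (fun x : ℝ => x ^ 2) Q := by
    rw [cfc_pow_id (R := ℝ) Q 2, sq]
  rw [h2, ← cfc_comp Real.sqrt (fun x : ℝ => x ^ 2) Q]
  conv_rhs => rw [← cfc_id ℝ Q]
  refine cfc_congr fun x hx => ?_
  have hx0 : 0 ≤ x := by
    rw [hQ.isHermitian.spectrum_real_eq_range_eigenvalues] at hx
    obtain ⟨i, rfl⟩ := hx
    exact hQ.eigenvalues_nonneg i
  simp [Real.sqrt_sq hx0]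

theorem partialTranspose_kronecker {m n : Type*} (M : Matrix m m ℂ) (N : Matrix n n ℂ) :
    partialTranspose (M ⊗ₖ N) = Mᵀ ⊗ₖ N := by
  ext x y; simp [partialTranspose]

theorem partialTranspose_sum {m n ι : Type*} (s : Finset ι)
    (M : ι → Matrix (m × n) (m × n) ℂ) :
    partialTranspose (∑ i ∈ s, M i) = ∑ i ∈ s, partialTranspose (M i) := by
  ext x y; simp [partialTranspose, Matrix.sum_apply]

/-- The logarithmic negativity of the partial trace of a superposition `∑ i, u i ⊗ w i` whose
branches are locally distinguishable, and locally interchangeable, on either side. -/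
theorem logNegativity_sum_kronecker {m n α β ι : Type*} [Fintype m] [Fintype n] [Fintype α]
    [Fintype β] [Fintype ι] [DecidableEq m] [DecidableEq n] [DecidableEq ι]
    (u : ι → Matrix m α ℂ) (w : ι → Matrix n β ℂ) (D : Matrix α α ℂ) (F : Matrix β β ℂ)
    (hu : ∀ i j, (u i)ᴴ * u j = if i = j then D else 0)
    (hw : ∀ i j, (w i)ᴴ * w j = if i = j then F else 0)
    (hnorm : (∑ i, ∑ j, (u i * (u j)ᴴ) ⊗ₖ (w i * (w j)ᴴ)).trace = 1) :
    logNegativity (∑ i, ∑ j, (u i * (u j)ᴴ) ⊗ₖ (w i * (w j)ᴴ)) =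
      Real.logb 2 (Fintype.card ι) := by
  -- Transposing `u i * (u j)ᴴ` gives the product of the complex conjugates with the labels
  -- exchanged.
  let v : ι → Matrix m α ℂ := fun i => (u i).map (starRingEnd ℂ)
  have hv : ∀ i j, (v i)ᴴ * v j = if i = j then D.map (starRingEnd ℂ) else 0 := by
    intro i j
    have : (v i)ᴴ * v j = ((u i)ᴴ * u j).map (starRingEnd ℂ) := by
      ext a b; simp [v, Matrix.mul_apply, Matrix.map_apply]
    rw [this, hu]
    split_ifs
    · rfl
    · ext; simp
  have hT : ∀ i j, (u i * (u j)ᴴ)ᵀ = v j * (v i)ᴴ := by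
    intro i j
    ext a b
    simp [v, Matrix.mul_apply, Matrix.map_apply, mul_comm]
  have hX : partialTranspose (∑ i, ∑ j, (u i * (u j)ᴴ) ⊗ₖ (w i * (w j)ᴴ)) =
      ∑ i, ∑ j, (v j * (v i)ᴴ) ⊗ₖ (w i * (w j)ᴴ) := by
    simp_rw [partialTranspose_sum, partialTranspose_kronecker, hT]
  have mulv : ∀ i j k l, (v i * (v j)ᴴ) * (v k * (v l)ᴴ) =
      if j = k then v i * D.map (starRingEnd ℂ) * (v l)ᴴ else 0 := by
    intro i j k l
    rw [Matrix.mul_assoc, ← Matrix.mul_assoc (v j)ᴴ, hv]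
    split_ifs <;> simp [Matrix.mul_assoc]
  have mulw : ∀ i j k l, (w i * (w j)ᴴ) * (w k * (w l)ᴴ) =
      if j = k then w i * F * (w l)ᴴ else 0 := by
    intro i j k l
    rw [Matrix.mul_assoc, ← Matrix.mul_assoc (w j)ᴴ, hw]
    split_ifs <;> simp [Matrix.mul_assoc]
  have mulvw : ∀ i j k l i' j' k' l',
      ((v i * (v j)ᴴ) ⊗ₖ (w i' * (w j')ᴴ)) * ((v k * (v l)ᴴ) ⊗ₖ (w k' * (w l')ᴴ)) =
      if j = k then if j' = k' then
        (v i * D.map (starRingEnd ℂ) * (v l)ᴴ) ⊗ₖ (w i' * F * (w l')ᴴ) else 0 else 0 := by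
    intro i j k l i' j' k' l'
    rw [← Matrix.mul_kronecker_mul, mulv, mulw]
    split_ifs <;> simp
  -- The candidate for the absolute value: the partial transpose differs from `Q` by a swap of
  -- labels between the factors, which disappears in `Xᴴ * X`.
  let Q : Matrix (m × n) (m × n) ℂ := ∑ i, ∑ j, (v i * (v i)ᴴ) ⊗ₖ (w j * (w j)ᴴ)
  have hQ : Q.PosSemidef := Matrix.posSemidef_sum _ fun i _ => Matrix.posSemidef_sum _ fun j _ =>
    (Matrix.posSemidef_self_mul_conjTranspose _).kronecker
      (Matrix.posSemidef_self_mul_conjTranspose _)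
  have hQQ : Q * Q = ∑ i, ∑ j, (v i * D.map (starRingEnd ℂ) * (v i)ᴴ) ⊗ₖ (w j * F * (w j)ᴴ) := by
    simp only [Q, Matrix.sum_mul, Matrix.mul_sum, mulvw, Finset.sum_ite_eq', Finset.mem_univ,
      if_true, Finset.sum_ite_irrel, Finset.sum_const_zero]
  have hXX : (∑ i, ∑ j, (v j * (v i)ᴴ) ⊗ₖ (w i * (w j)ᴴ))ᴴ *
      (∑ i, ∑ j, (v j * (v i)ᴴ) ⊗ₖ (w i * (w j)ᴴ)) = Q * Q := by
    rw [hQQ]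
    simp only [Matrix.conjTranspose_sum, Matrix.conjTranspose_kronecker, Matrix.conjTranspose_mul,
      Matrix.conjTranspose_conjTranspose, Matrix.sum_mul, Matrix.mul_sum, mulvw,
      Finset.sum_ite_eq', Finset.mem_univ, if_true]
  have tru : ∀ i j, (u i * (u j)ᴴ).trace = if i = j then D.trace else 0 := by
    intro i j
    rw [Matrix.trace_mul_comm, hu]
    by_cases h : i = j
    · simp [h]
    · simp [h, Ne.symm h]
  have trv : ∀ i, (v i * (v i)ᴴ).trace = D.trace := by
    intro i
    rw [← hT, Matrix.trace_transpose, tru, if_pos rfl]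
  have trw : ∀ i j, (w i * (w j)ᴴ).trace = if i = j then F.trace else 0 := by
    intro i j
    rw [Matrix.trace_mul_comm, hw]
    by_cases h : i = j
    · simp [h]
    · simp [h, Ne.symm h]
  -- Only equal labels contribute to the trace of the state, one term per label, whereas every pair
  -- of labels contributes to the trace of `Q`.
  have h1 : (Fintype.card ι : ℂ) * (D.trace * F.trace) = 1 := by
    rw [← hnorm]
    simp [Matrix.trace_sum, Matrix.trace_kronecker, tru, trw]
  have htr : Q.trace = Fintype.card ι := by
    have : Q.trace = Fintype.card ι * (Fintype.card ι * (D.trace * F.trace)) := by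
      simp [Q, Matrix.trace_sum, Matrix.trace_kronecker, trv, trw]
    rw [this, h1, mul_one]
  rw [logNegativity, hX, matrixAbs_eq_of_posSemidef hQ hXX, htr]
  simp

/-! ### Pauli operators in coordinates and the ground space -/

/-- Only the parity of the exponent matters since `σˣ` squares to 1. As `ZMod 2` is `Fin 2` by
definition, basis labels can be added. -/
theorem sigmaX_pow_apply (k : ℕ) (a b : ZMod 2) :
    (sigmaX ^ k) a b = if b = a + k then 1 else 0 := by
  have h2 : sigmaX ^ 2 = 1 := by
    ext i j; fin_cases i <;> fin_cases j <;> simp [sigmaX, sq]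
  have hk : (k : ZMod 2) = ((k % 2 : ℕ) : ZMod 2) := by simp
  rw [← Nat.div_add_mod k 2, pow_add, pow_mul, h2, one_pow, one_mul, Nat.div_add_mod, hk]
  rcases Nat.mod_two_eq_zero_or_one k with h | h <;> rw [h]
  · have h0 : ∀ a b : Fin 2, (1 : Matrix (Fin 2) (Fin 2) ℂ) a b = if b = a then 1 else 0 := by
      intro a b; simp [Matrix.one_apply, eq_comm]
    rw [pow_zero, Nat.cast_zero, add_zero]
    exact h0 a b
  · have h1 : ∀ a b : Fin 2, sigmaX a b = if b = a + 1 then 1 else 0 := by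
      intro a b; fin_cases a <;> fin_cases b <;> simp [sigmaX]
    rw [pow_one, Nat.cast_one]
    exact h1 a b

/-- The eigenvalue `±1` of `σᶻ`, as a character of `ZMod 2`. -/
def zSign (a : ZMod 2) : ℝ := if a = 0 then 1 else -1

theorem zSign_zero : zSign 0 = 1 := if_pos rfl

theorem zSign_add (a b : ZMod 2) : zSign (a + b) = zSign a * zSign b := by
  have h : ∀ a : ZMod 2, a = 0 ∨ a = 1 := by decide
  have h2 : (1 + 1 : ZMod 2) = 0 := rfl
  rcases h a with rfl | rfl <;> rcases h b with rfl | rfl <;> simp [zSign, h2]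

theorem zSign_sum {E : Type*} (s : Finset E) (f : E → ZMod 2) :
    zSign (∑ e ∈ s, f e) = ∏ e ∈ s, zSign (f e) := by
  classical
  induction s using Finset.induction_on with
  | empty => simp [zSign_zero]
  | insert a s ha ih => rw [Finset.sum_insert ha, Finset.prod_insert ha, zSign_add, ih]

theorem zSign_le_one (a : ZMod 2) : zSign a ≤ 1 := by
  rw [zSign]; split_ifs <;> norm_num

theorem sigmaZ_pow_apply (k : ℕ) (a b : ZMod 2) :
    (sigmaZ ^ k) a b = if b = a then ((zSign (a * k) : ℝ) : ℂ) else 0 := by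
  have h2 : sigmaZ ^ 2 = 1 := by
    ext i j; fin_cases i <;> fin_cases j <;> simp [sigmaZ, sq]
  have hk : (k : ZMod 2) = ((k % 2 : ℕ) : ZMod 2) := by simp
  rw [← Nat.div_add_mod k 2, pow_add, pow_mul, h2, one_pow, one_mul, Nat.div_add_mod, hk]
  rcases Nat.mod_two_eq_zero_or_one k with h | h <;> rw [h]
  · have h0 : ∀ a b : Fin 2, (1 : Matrix (Fin 2) (Fin 2) ℂ) a b = if b = a then 1 else 0 := by
      intro a b; simp [Matrix.one_apply, eq_comm]
    rw [pow_zero, Nat.cast_zero, mul_zero, zSign_zero, Complex.ofReal_one]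
    exact h0 a b
  · have h1 : ∀ a b : Fin 2, sigmaZ a b =
        if b = a then (((if a = 0 then 1 else -1 : ℝ)) : ℂ) else 0 := by
      intro a b; fin_cases a <;> fin_cases b <;> simp [sigmaZ]
    rw [pow_one, Nat.cast_one, mul_one]
    exact h1 a b

namespace SurfaceLattice

variable {Φ : Type*} [Finite Φ] (C : SurfaceLattice Φ)

/-- The edges, counted modulo 2, on which a star operator acts. -/
def starVec (v : C.Vertex) (e : C.Edge) : ZMod 2 := C.legs v e

theorem coboundary_single (v : C.Vertex) : C.coboundary (Pi.single v 1) = C.starVec v := by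
  funext e
  rw [coboundary, Finset.sum_eq_single v]
  · simp [starVec]
  · intro w _ hw; simp [hw]
  · simp

theorem coboundary_zero : C.coboundary 0 = 0 := by
  funext e; simp [coboundary]

theorem starOp_mulVec (v : C.Vertex) (ψ : (C.Edge → ZMod 2) → ℂ) (s : C.Edge → ZMod 2) :
    (C.starOp v *ᵥ ψ) s = ψ (s + C.starVec v) := by
  have h : ∀ t : C.Edge → ZMod 2, C.starOp v s t = if t = s + C.starVec v then 1 else 0 := by
    intro t
    change ∏ e, (sigmaX ^ C.legs v e) (s e) (t e) = _
    by_cases ht : t = s + C.starVec v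
    · rw [if_pos ht]
      refine Finset.prod_eq_one fun e _ => ?_
      rw [sigmaX_pow_apply, ht, if_pos]; rfl
    · rw [if_neg ht]
      obtain ⟨e, he⟩ := Function.ne_iff.mp ht
      refine Finset.prod_eq_zero (Finset.mem_univ e) ?_
      rw [sigmaX_pow_apply, if_neg]; exact he
  change ∑ t : C.Edge → ZMod 2, C.starOp v s t * ψ t = _
  simp [h]

theorem plaquetteOp_mulVec (p : C.Face) (ψ : (C.Edge → ZMod 2) → ℂ) (s : C.Edge → ZMod 2) :
    (C.plaquetteOp p *ᵥ ψ) s = (zSign (C.circulation s p) : ℂ) * ψ s := by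
  have h : ∀ t : C.Edge → ZMod 2, C.plaquetteOp p s t =
      if t = s then (zSign (C.circulation s p) : ℂ) else 0 := by
    intro t
    change ∏ e, (sigmaZ ^ C.sides p e) (s e) (t e) = _
    by_cases ht : t = s
    · rw [if_pos ht, circulation, zSign_sum, Complex.ofReal_prod]
      refine Finset.prod_congr rfl fun e _ => ?_
      rw [sigmaZ_pow_apply, ht, if_pos rfl]
    · rw [if_neg ht]
      obtain ⟨e, he⟩ := Function.ne_iff.mp ht
      refine Finset.prod_eq_zero (Finset.mem_univ e) ?_
      rw [sigmaZ_pow_apply, if_neg he]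
  change ∑ t : C.Edge → ZMod 2, C.plaquetteOp p s t * ψ t = _
  simp [h]

theorem hamiltonian_mulVec (S : Finset C.Vertex) (P : Finset C.Face) (U J : ℝ)
    (ψ : (C.Edge → ZMod 2) → ℂ) (s : C.Edge → ZMod 2) :
    (C.hamiltonian S P U J *ᵥ ψ) s = -(U : ℂ) * ∑ v ∈ S, ψ (s + C.starVec v) -
      (J : ℂ) * ∑ p ∈ P, (zSign (C.circulation s p) : ℂ) * ψ s := by
  have key : ∀ (φ : (C.Edge → Fin 2) → ℂ) (t : C.Edge → Fin 2),
      (C.hamiltonian S P U J *ᵥ φ) t = -(U : ℂ) * ∑ v ∈ S, (C.starOp v *ᵥ φ) t -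
        (J : ℂ) * ∑ p ∈ P, (C.plaquetteOp p *ᵥ φ) t := by
    intro φ t
    rw [hamiltonian, Matrix.sub_mulVec, Pi.sub_apply, Matrix.smul_mulVec, Matrix.smul_mulVec,
      Matrix.sum_mulVec, Matrix.sum_mulVec]
    simp only [Pi.smul_apply, smul_eq_mul, Finset.sum_apply]
  exact (key ψ s).trans (congrArg₂ (fun x y => -(U : ℂ) * x - (J : ℂ) * y)
    (Finset.sum_congr rfl fun v _ => C.starOp_mulVec v ψ s)
    (Finset.sum_congr rfl fun p _ => C.plaquetteOp_mulVec p ψ s))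

/-- The lowest energy is at most that of the simultaneous stabilisation of all terms. -/
theorem groundEnergy_le (S : Finset C.Vertex) (P : Finset C.Face) (U J : ℝ)
    {E₀ : ℝ} (h : ∀ (E : ℝ) (φ : (C.Edge → ZMod 2) → ℂ), φ ≠ 0 →
      C.hamiltonian S P U J *ᵥ φ = (E : ℂ) • φ → E₀ ≤ E) :
    E₀ ≤ -U * S.card - J * P.card := by
  classical
  -- The trial state is the unnormalised uniform superposition of all coboundaries, which every star
  -- permutes and no plaquette sees.
  let φ : (C.Edge → ZMod 2) → ℂ := fun s => if ∃ f, s = C.coboundary f then 1 else 0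
  refine h _ φ ?_ ?_
  · intro h0
    have := congrFun h0 0
    have h1 : ∃ f, (0 : C.Edge → ZMod 2) = C.coboundary f := ⟨0, C.coboundary_zero.symm⟩
    simp [φ, h1] at this
  · refine funext fun (s : C.Edge → ZMod 2) => ?_
    have e1 : ∀ v, φ (s + C.starVec v) = φ s := by
      intro v
      have : (∃ f, s + C.starVec v = C.coboundary f) ↔ ∃ f, s = C.coboundary f := by
        rw [← coboundary_single]
        have hh : C.coboundary (Pi.single v 1) + C.coboundary (Pi.single v 1) = 0 := by
          funext e; exact ZMod.two_add_self _
        constructor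
        · rintro ⟨f, hf⟩
          exact ⟨f + Pi.single v 1, by rw [coboundary_add, ← hf, add_assoc, hh, add_zero]⟩
        · rintro ⟨f, rfl⟩
          exact ⟨f + Pi.single v 1, by rw [coboundary_add]⟩
      simp only [φ, this]
    have e2 : ∀ p, (zSign (C.circulation s p) : ℂ) * φ s = φ s := by
      intro p
      by_cases hs : ∃ f, s = C.coboundary f
      · obtain ⟨f, rfl⟩ := hs
        rw [circulation_coboundary, zSign_zero]; simp
      · simp [φ, hs]
    refine (C.hamiltonian_mulVec S P U J φ s).trans ?_
    change _ = ((-U * S.card - J * P.card : ℝ) : ℂ) * φ s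
    simp only [e1, e2, Finset.sum_const, nsmul_eq_mul]
    push_cast; ring

/-- Ground states of the toric code satisfy all star and plaquette conditions. -/
theorem IsGroundState.stabilized {C : SurfaceLattice Φ} {S : Finset C.Vertex} {P : Finset C.Face}
    {U J : ℝ} (hU : 0 < U) (hJ : 0 < J) {ψ : (C.Edge → ZMod 2) → ℂ}
    (hψ : IsGroundState (C.hamiltonian S P U J) ψ) :
    (∀ v ∈ S, ∀ s, ψ (s + C.starVec v) = ψ s) ∧
      ∀ s, ψ s ≠ 0 → ∀ p ∈ P, C.circulation s p = 0 := by
  classical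
  obtain ⟨hnorm, E₀, hE, hmin⟩ := hψ
  have hnorm' : ∑ s : C.Edge → ZMod 2, ‖ψ s‖ ^ 2 = 1 := hnorm
  have hle := C.groundEnergy_le S P U J hmin
  have hHs : ∀ s : C.Edge → ZMod 2, (E₀ : ℂ) * ψ s = -(U : ℂ) * ∑ v ∈ S, ψ (s + C.starVec v) -
      (J : ℂ) * ∑ p ∈ P, (zSign (C.circulation s p) : ℂ) * ψ s := by
    intro s
    rw [← hamiltonian_mulVec, hE]; rfl
  -- `a v` and `b p` are the expectation values of the star and plaquette operators in `ψ`.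
  let a : C.Vertex → ℝ := fun v =>
    ∑ s : C.Edge → ZMod 2, (starRingEnd ℂ (ψ s) * ψ (s + C.starVec v)).re
  let b : C.Face → ℝ := fun p => ∑ s : C.Edge → ZMod 2, zSign (C.circulation s p) * ‖ψ s‖ ^ 2
  have hE0 : E₀ = -U * ∑ v ∈ S, a v - J * ∑ p ∈ P, b p := by
    have h1 : ∀ s : C.Edge → ZMod 2, E₀ * ‖ψ s‖ ^ 2 =
        -U * ∑ v ∈ S, (starRingEnd ℂ (ψ s) * ψ (s + C.starVec v)).re -
          J * ∑ p ∈ P, zSign (C.circulation s p) * ‖ψ s‖ ^ 2 := by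
      intro s
      have hc : ∀ r : ℝ, (starRingEnd ℂ (ψ s) * ((r : ℂ) * ψ s)).re = r * ‖ψ s‖ ^ 2 := by
        intro r
        rw [mul_left_comm, Complex.conj_mul', ← Complex.ofReal_pow, ← Complex.ofReal_mul,
          Complex.ofReal_re]
      have hz : ∑ p ∈ P, zSign (C.circulation s p) * ‖ψ s‖ ^ 2 =
          (starRingEnd ℂ (ψ s) * ∑ p ∈ P, (zSign (C.circulation s p) : ℂ) * ψ s).re := by
        rw [← Finset.sum_mul, ← hc, Complex.ofReal_sum, Finset.sum_mul]
      rw [hz, ← hc, hHs s, ← Complex.re_sum, ← Finset.mul_sum, mul_sub, Complex.sub_re,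
        mul_left_comm, ← Complex.ofReal_neg, Complex.re_ofReal_mul,
        mul_left_comm (starRingEnd ℂ (ψ s)), Complex.re_ofReal_mul]
    calc E₀ = ∑ s : C.Edge → ZMod 2, E₀ * ‖ψ s‖ ^ 2 := by rw [← Finset.mul_sum, hnorm', mul_one]
      _ = _ := by
        simp_rw [h1]
        rw [Finset.sum_sub_distrib, ← Finset.mul_sum, ← Finset.mul_sum, Finset.sum_comm,
          Finset.sum_comm (s := Finset.univ) (t := P)]
  -- The squared distance between `ψ` and its translate measures the deficit of `a v` from 1, so
  -- zero deficit means invariance.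
  have ha : ∀ v, ∑ s : C.Edge → ZMod 2, ‖ψ (s + C.starVec v) - ψ s‖ ^ 2 = 2 * (1 - a v) := by
    intro v
    have h1 : ∀ s : C.Edge → ZMod 2, ‖ψ (s + C.starVec v) - ψ s‖ ^ 2 =
        ‖ψ (s + C.starVec v)‖ ^ 2 + ‖ψ s‖ ^ 2 -
          2 * (starRingEnd ℂ (ψ s) * ψ (s + C.starVec v)).re := by
      intro s
      simp only [← Complex.normSq_eq_norm_sq, Complex.normSq_sub]
      rw [mul_comm (starRingEnd ℂ (ψ s))]
    have h2 : ∑ s : C.Edge → ZMod 2, ‖ψ (s + C.starVec v)‖ ^ 2 = 1 := by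
      rw [← hnorm']
      exact Equiv.sum_comp (Equiv.addRight (C.starVec v)) fun s => ‖ψ s‖ ^ 2
    simp_rw [h1]
    rw [Finset.sum_sub_distrib, Finset.sum_add_distrib, h2, hnorm', ← Finset.mul_sum]
    ring
  have hb : ∀ p, ∑ s : C.Edge → ZMod 2, (1 - zSign (C.circulation s p)) * ‖ψ s‖ ^ 2 = 1 - b p := by
    intro p
    simp_rw [sub_mul, one_mul]
    rw [Finset.sum_sub_distrib, hnorm']
  have ha0 : ∀ v, 0 ≤ 1 - a v := fun v => by
    have : 0 ≤ ∑ s : C.Edge → ZMod 2, ‖ψ (s + C.starVec v) - ψ s‖ ^ 2 :=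
      Finset.sum_nonneg fun _ _ => by positivity
    rw [ha] at this; linarith
  have hbt : ∀ p (s : C.Edge → ZMod 2), 0 ≤ (1 - zSign (C.circulation s p)) * ‖ψ s‖ ^ 2 :=
    fun p s => mul_nonneg (by linarith [zSign_le_one (C.circulation s p)]) (by positivity)
  have hb0 : ∀ p, 0 ≤ 1 - b p := fun p => by
    rw [← hb]; exact Finset.sum_nonneg fun s _ => hbt p s
  have hA0 : 0 ≤ ∑ v ∈ S, (1 - a v) := Finset.sum_nonneg fun v _ => ha0 v
  have hB0 : 0 ≤ ∑ p ∈ P, (1 - b p) := Finset.sum_nonneg fun p _ => hb0 p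
  -- The energy bound makes the weighted total deficit nonpositive; since each deficit is
  -- nonnegative and `U`, `J` are positive, all vanish.
  have htot : U * ∑ v ∈ S, (1 - a v) + J * ∑ p ∈ P, (1 - b p) ≤ 0 := by
    simp only [Finset.sum_sub_distrib, Finset.sum_const, nsmul_eq_mul, mul_one]
    linarith
  have hUA := mul_nonneg hU.le hA0
  have hJB := mul_nonneg hJ.le hB0
  have hA1 : ∑ v ∈ S, (1 - a v) = 0 := by
    have : U * ∑ v ∈ S, (1 - a v) = 0 := by linarith
    exact (mul_eq_zero.mp this).resolve_left hU.ne'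
  have hB1 : ∑ p ∈ P, (1 - b p) = 0 := by
    have : J * ∑ p ∈ P, (1 - b p) = 0 := by linarith
    exact (mul_eq_zero.mp this).resolve_left hJ.ne'
  rw [Finset.sum_eq_zero_iff_of_nonneg fun v _ => ha0 v] at hA1
  rw [Finset.sum_eq_zero_iff_of_nonneg fun v _ => hb0 v] at hB1
  constructor
  · intro v hv s
    have h := ha v
    rw [hA1 v hv, mul_zero, Finset.sum_eq_zero_iff_of_nonneg fun _ _ => by positivity] at h
    have := h s (Finset.mem_univ _)
    exact sub_eq_zero.mp (by simpa using this)
  · intro s hs p hp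
    have h := hb p
    rw [hB1 p hp, Finset.sum_eq_zero_iff_of_nonneg fun s _ => hbt p s] at h
    have := (mul_eq_zero.mp (h s (Finset.mem_univ _))).resolve_right (by simpa using hs)
    by_contra hne
    rw [zSign, if_neg hne] at this
    norm_num at this

end SurfaceLattice

/-! ### Restricting configurations, branches and partial traces -/

/-- The configuration that is `a` on `X`, `c` on `Y` (for `Y` disjoint from `X`), and 0 elsewhere. -/
def join {E : Type*} [DecidableEq E] (X Y : Finset E) (a : {e // e ∈ X} → ZMod 2)
    (c : {e // e ∈ Y} → ZMod 2) (e : E) : ZMod 2 :=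
  if hX : e ∈ X then a ⟨e, hX⟩ else if hY : e ∈ Y then c ⟨e, hY⟩ else 0

/-- The restriction of a configuration to a region, extended by 0. -/
def mask {E : Type*} [DecidableEq E] (X : Finset E) (s : E → ZMod 2) (e : E) : ZMod 2 :=
  if e ∈ X then s e else 0

theorem mask_add {E : Type*} [DecidableEq E] (X : Finset E) (s t : E → ZMod 2) :
    mask X (s + t) = mask X s + mask X t := by
  funext e; by_cases h : e ∈ X <;> simp [mask, h]

theorem mask_add_mask_compl {E : Type*} [Fintype E] [DecidableEq E] (X : Finset E)
    (s : E → ZMod 2) : mask X s + mask Xᶜ s = s := by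
  funext e; by_cases h : e ∈ X <;> simp [mask, h]

/-- The branches `F (· + L i)` of a wave function on `X ∪ Y`, displaced by configurations on `X`. -/
def branch {E ι : Type*} [DecidableEq E] (X Y : Finset E) (F : (E → ZMod 2) → ℂ)
    (L : ι → E → ZMod 2) (i : ι) : Matrix ({e // e ∈ X} → ZMod 2) ({e // e ∈ Y} → ZMod 2) ℂ :=
  Matrix.of fun a c => F (join X Y a c + L i)

/-- `L i` lives on `X`, so it merely permutes the row index summed over, and the diagonal blocks do
not depend on `i`. Off the diagonal every summand vanishes, since no row is nonzero in two branches.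
-/
theorem branch_conjTranspose_mul {E ι : Type*} [DecidableEq E] [DecidableEq ι] (X Y : Finset E)
    (F : (E → ZMod 2) → ℂ) (L : ι → E → ZMod 2) (hL : ∀ i, ∀ e ∉ X, L i e = 0)
    (h : ∀ i j a c c', F (join X Y a c + L i) ≠ 0 → F (join X Y a c' + L j) ≠ 0 → i = j) (i j : ι) :
    (branch X Y F L i)ᴴ * branch X Y F L j =
      if i = j then Matrix.of fun c c' => ∑ a, star (F (join X Y a c)) * F (join X Y a c')
      else 0 := by
  ext c c'
  rw [Matrix.mul_apply]
  by_cases hij : i = j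
  · subst hij
    have key : ∀ a c, join X Y a c + L i = join X Y (a + fun e : {e // e ∈ X} => L i e) c := by
      intro a c
      funext e
      by_cases he : e ∈ X
      · simp [join, he]
      · simp [join, he, hL i e he]
    simp only [branch, Matrix.conjTranspose_apply, Matrix.of_apply, if_true, key]
    exact Equiv.sum_comp (Equiv.addRight (fun e : {e // e ∈ X} => L i e))
      fun a => star (F (join X Y a c)) * F (join X Y a c')
  · rw [if_neg hij]
    refine Finset.sum_eq_zero fun a _ => ?_
    simp only [branch, Matrix.conjTranspose_apply, Matrix.of_apply]
    by_contra hne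
    refine hij (h i j a c c' ?_ (right_ne_zero_of_mul hne))
    simpa using left_ne_zero_of_mul hne

theorem glue_bijective {E : Type*} [DecidableEq E] {X Y : Finset E} (hXY : Disjoint X Y) :
    Function.Bijective fun x : (({e // e ∈ X} → Fin 2) × ({e // e ∈ Y} → Fin 2)) ×
      ({e // e ∉ X ∧ e ∉ Y} → Fin 2) => glue X Y x.1.1 x.1.2 x.2 := by
  constructor
  · rintro ⟨⟨a, b⟩, c⟩ ⟨⟨a', b'⟩, c'⟩ h
    have h' : ∀ e, glue X Y a b c e = glue X Y a' b' c' e := congrFun h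
    refine Prod.ext (Prod.ext (funext fun e => ?_) (funext fun e => ?_)) (funext fun e => ?_)
    · simpa [glue, e.2] using h' e
    · have := Finset.disjoint_right.mp hXY e.2
      simpa [glue, e.2, this] using h' e
    · simpa [glue, e.2.1, e.2.2] using h' e
  · intro s
    refine ⟨⟨⟨fun e => s e, fun e => s e⟩, fun e => s e⟩, funext fun e => ?_⟩
    by_cases h1 : e ∈ X <;> by_cases h2 : e ∈ Y <;> simp [glue, h1, h2]

theorem trace_reducedState {E : Type*} [Fintype E] [DecidableEq E] {X Y : Finset E}
    (hXY : Disjoint X Y) (ψ : (E → Fin 2) → ℂ) :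
    (reducedState (pureState ψ) X Y).trace = ((∑ s, ‖ψ s‖ ^ 2 : ℝ) : ℂ) := by
  have h1 : ((∑ s, ‖ψ s‖ ^ 2 : ℝ) : ℂ) = ∑ s, pureState ψ s s := by
    push_cast
    refine Finset.sum_congr rfl fun s _ => ?_
    simp [pureState, Matrix.vecMulVec_apply, Complex.mul_conj']
  rw [h1, Matrix.trace, ← Fintype.sum_bijective _ (glue_bijective hXY) _ _ fun _ => rfl,
    Fintype.sum_prod_type (α₁ := ({e // e ∈ X} → Fin 2) × ({e // e ∈ Y} → Fin 2))]
  rfl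

/-- The traced out configurations split into their parts on `X'` and on `Y'`. -/
def splitRest {E : Type*} [DecidableEq E] {X X' Y Y' : Finset E}
    (hcover : ∀ e, e ∈ X ∨ e ∈ X' ∨ e ∈ Y ∨ e ∈ Y') (hX' : ∀ e ∈ X', e ∉ X ∧ e ∉ Y ∧ e ∉ Y')
    (hY' : ∀ e ∈ Y', e ∉ X ∧ e ∉ Y) : ({e // e ∉ X ∧ e ∉ Y} → ZMod 2) ≃
      ({e // e ∈ X'} → ZMod 2) × ({e // e ∈ Y'} → ZMod 2) where
  toFun c := (fun e => c ⟨e, (hX' e e.2).1, (hX' e e.2).2.1⟩, fun e => c ⟨e, hY' e e.2⟩)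
  invFun x := fun e => if h : e.1 ∈ X' then x.1 ⟨e, h⟩ else
    x.2 ⟨e, ((hcover e).resolve_left e.2.1).resolve_left h |>.resolve_left e.2.2⟩
  left_inv c := by
    funext e; by_cases h : e.1 ∈ X' <;> simp [h]
  right_inv x := by
    refine Prod.ext (funext fun e => ?_) (funext fun e => ?_)
    · simp [e.2]
    · have : e.1 ∉ X' := fun h => (hX' e h).2.2 e.2
      simp [this]

/-- The reduced state of a superposition of products of branches. -/
theorem reducedState_eq_sum_kronecker {E ι : Type*} [Fintype E] [DecidableEq E] [Fintype ι]
    {X X' Y Y' : Finset E}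
    (hcover : ∀ e, e ∈ X ∨ e ∈ X' ∨ e ∈ Y ∨ e ∈ Y') (hX' : ∀ e ∈ X', e ∉ X ∧ e ∉ Y ∧ e ∉ Y')
    (hY' : ∀ e ∈ Y', e ∉ X ∧ e ∉ Y) (hXY : Disjoint X Y) (F F' : (E → ZMod 2) → ℂ)
    (l : ι → E → ZMod 2) (ψ : (E → ZMod 2) → ℂ)
    (hψ : ∀ s, ψ s = ∑ i, F (mask (X ∪ X') (s + l i)) * F' (mask (Y ∪ Y') (s + l i))) :
    Eq (α := Matrix (({e // e ∈ X} → ZMod 2) × ({e // e ∈ Y} → ZMod 2))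
      (({e // e ∈ X} → ZMod 2) × ({e // e ∈ Y} → ZMod 2)) ℂ) (reducedState (pureState ψ) X Y) <|
    ∑ i, ∑ j, (branch X X' F (fun i => mask (X ∪ X') (l i)) i *
        (branch X X' F (fun i => mask (X ∪ X') (l i)) j)ᴴ) ⊗ₖ
      (branch Y Y' F' (fun i => mask (Y ∪ Y') (l i)) i *
        (branch Y Y' F' (fun i => mask (Y ∪ Y') (l i)) j)ᴴ) := by
  -- `G` is `glue` retyped over `ZMod 2`, so that configurations can be added.
  obtain ⟨G, hG⟩ : ∃ G : ({e // e ∈ X} → ZMod 2) → ({e // e ∈ Y} → ZMod 2) →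
      ({e // e ∉ X ∧ e ∉ Y} → ZMod 2) → E → ZMod 2, G = glue X Y := ⟨_, rfl⟩
  have hGe : ∀ a b c e, G a b c e = if hX : e ∈ X then a ⟨e, hX⟩ else
      if hY : e ∈ Y then b ⟨e, hY⟩ else c ⟨e, hX, hY⟩ := by
    rw [hG]; intros; rfl
  let σ := splitRest hcover hX' hY'
  let u := branch X X' F (fun i => mask (X ∪ X') (l i))
  let w := branch Y Y' F' (fun i => mask (Y ∪ Y') (l i))
  have hX1 : ∀ a b (c : {e // e ∉ X ∧ e ∉ Y} → ZMod 2),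
      mask (X ∪ X') (G a b c) = join X X' a (σ c).1 := by
    intro a b c
    funext e
    by_cases h1 : e ∈ X
    · simp [mask, hGe, join, h1]
    · by_cases h2 : e ∈ X'
      · have := hX' e h2
        simp [mask, hGe, join, h1, h2, this, σ, splitRest]
      · simp [mask, join, h1, h2]
  have hY1 : ∀ a b (c : {e // e ∉ X ∧ e ∉ Y} → ZMod 2),
      mask (Y ∪ Y') (G a b c) = join Y Y' b (σ c).2 := by
    intro a b c
    funext e
    by_cases h1 : e ∈ Y
    · have := Finset.disjoint_right.mp hXY h1
      simp [mask, hGe, join, h1, this]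
    · by_cases h2 : e ∈ Y'
      · have := hY' e h2
        simp [mask, hGe, join, h2, this, σ, splitRest]
      · simp [mask, join, h1, h2]
  have hψ' : ∀ a b (c : {e // e ∉ X ∧ e ∉ Y} → ZMod 2),
      ψ (G a b c) = ∑ i, u i a (σ c).1 * w i b (σ c).2 := by
    intro a b c
    refine (hψ _).trans (Finset.sum_congr rfl fun i _ => ?_)
    rw [mask_add, mask_add, hX1, hY1]; rfl
  refine Matrix.ext fun (x y : ({e // e ∈ X} → ZMod 2) × ({e // e ∈ Y} → ZMod 2)) => ?_
  have hl : reducedState (pureState ψ) X Y x y = ∑ c : {e // e ∉ X ∧ e ∉ Y} → ZMod 2,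
      ψ (G x.1 x.2 c) * star (ψ (G y.1 y.2 c)) := by
    rw [hG]; rfl
  refine hl.trans ?_
  simp_rw [hψ']
  -- Splitting the traced out configuration into its two parts makes each summand factor over the
  -- two sides.
  rw [Equiv.sum_comp σ fun z => (∑ i, u i x.1 z.1 * w i x.2 z.2) *
    star (∑ i, u i y.1 z.1 * w i y.2 z.2), Fintype.sum_prod_type]
  simp only [Matrix.sum_apply, Matrix.kroneckerMap_apply, Matrix.mul_apply,
    Matrix.conjTranspose_apply]
  simp only [star_sum, star_mul', Finset.sum_mul_sum]
  change ∑ c, ∑ d, ∑ i, ∑ j, _ = ∑ i, ∑ j, ∑ c, ∑ d, _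
  calc _ = ∑ c, ∑ i, ∑ d, ∑ j, _ := Finset.sum_congr rfl fun _ _ => Finset.sum_comm
    _ = ∑ i, ∑ c, ∑ d, ∑ j, _ := Finset.sum_comm
    _ = ∑ i, ∑ c, ∑ j, ∑ d, _ := Finset.sum_congr rfl fun _ _ => Finset.sum_congr rfl fun _ _ =>
        Finset.sum_comm
    _ = ∑ i, ∑ j, ∑ c, ∑ d, _ := Finset.sum_congr rfl fun _ _ => Finset.sum_comm
    _ = _ := by
      refine Finset.sum_congr rfl fun i _ => Finset.sum_congr rfl fun j _ =>
        Finset.sum_congr rfl fun c _ => Finset.sum_congr rfl fun d _ => ?_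
      simp only [u, w]
      ring

/-! ### The Schmidt decomposition across the boundary of a disc -/

namespace SurfaceLattice

theorem noBorder_empty {Φ : Type*} (C : SurfaceLattice Φ) (R : Finset C.Edge) : C.NoBorder ∅ R := by
  constructor <;> rintro _ ⟨⟨_, _, h⟩, _⟩ <;> simp at h

variable {Φ : Type*} [Finite Φ] (C : SurfaceLattice Φ)

theorem coboundary_eq_sum (f : C.Vertex → ZMod 2) :
    C.coboundary f = ∑ v, f v • C.starVec v := by
  funext e; simp [coboundary, starVec]

theorem apply_add_coboundary {C : SurfaceLattice Φ} {S : Finset C.Vertex}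
    {ψ : (C.Edge → ZMod 2) → ℂ} (hψ : ∀ v ∈ S, ∀ s, ψ (s + C.starVec v) = ψ s)
    {f : C.Vertex → ZMod 2} (hf : ∀ v, f v ≠ 0 → v ∈ S) (s : C.Edge → ZMod 2) :
    ψ (s + C.coboundary f) = ψ s := by
  classical
  rw [coboundary_eq_sum]
  generalize (Finset.univ : Finset C.Vertex) = T
  induction T using Finset.induction_on generalizing s with
  | empty => simp
  | insert v T hv ih =>
    rw [Finset.sum_insert hv, ← add_assoc, ih]
    have h01 : ∀ a : ZMod 2, a = 0 ∨ a = 1 := by decide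
    rcases h01 (f v) with h | h
    · simp [h]
    · rw [h, one_smul]
      exact hψ v (hf v (by simp [h])) s

theorem coboundary_congr {f g : C.Vertex → ZMod 2} {R : Finset C.Edge}
    (h : ∀ v, C.StarMeets v R → f v = g v) {e : C.Edge} (he : e ∈ R) :
    C.coboundary f e = C.coboundary g e := by
  obtain ⟨x, rfl⟩ := C.edge_surjective e
  rw [coboundary_edge, coboundary_edge, h _ ⟨x, rfl, he⟩,
    h _ ⟨C.a0 x, rfl, by rwa [C.edge_a0]⟩]

theorem circulation_congr {s t : C.Edge → ZMod 2} {p : C.Face}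
    (h : ∀ x, C.face x = p → s (C.edge x) = t (C.edge x)) :
    C.circulation s p = C.circulation t p := by
  refine Finset.sum_congr rfl fun e _ => ?_
  obtain ⟨x, rfl⟩ := C.edge_surjective e
  rw [sides_edge]
  by_cases h1 : C.face x = p
  · rw [h x h1]
  by_cases h2 : C.face (C.a2 x) = p
  · have := h _ h2
    rw [C.edge_a2] at this
    rw [this]
  · simp [h1, h2]

theorem starMeets_or_compl (v : C.Vertex) (R : Finset C.Edge) :
    C.StarMeets v R ∨ C.StarMeets v Rᶜ := by
  obtain ⟨x, rfl⟩ := C.vertex_surjective v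
  by_cases hx : C.edge x ∈ R
  · exact Or.inl ⟨x, rfl, hx⟩
  · exact Or.inr ⟨x, rfl, Finset.mem_compl.mpr hx⟩

/-- A face that misses `R` sees only zeros, so holes away from `R` do no harm. -/
theorem circulation_mask_eq_zero {P : Finset C.Face} {R : Finset C.Edge} {s : C.Edge → ZMod 2}
    (hRP : ∀ p, C.PlaquetteMeets p R → p ∈ P)
    (hs : ∀ p ∈ P, C.circulation (mask R s) p = 0) (p : C.Face) :
    C.circulation (mask R s) p = 0 := by
  by_cases hp : C.PlaquetteMeets p R
  · exact hs p (hRP p hp)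
  · rw [C.circulation_congr (t := 0) fun x hx => if_neg fun h => hp ⟨x, hx, h⟩, circulation_zero]
    rfl

/-- The vertices on the boundary of `A` apart from `v₀`; their stars label the branches of the
Schmidt decomposition. -/
abbrev BoundaryVertex (A : Finset C.Edge) (v₀ : C.Vertex) : Type _ :=
  {v // (C.StarMeets v A ∧ C.StarMeets v Aᶜ) ∧ v ≠ v₀}

open Classical in
instance (A : Finset C.Edge) (v₀ : C.Vertex) : Fintype (C.BoundaryVertex A v₀) :=
  Subtype.fintype _

open Classical in
/-- A weight on the boundary vertices, extended by 0. -/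
def boundaryWeight (A : Finset C.Edge) (v₀ : C.Vertex) (i : C.BoundaryVertex A v₀ → ZMod 2)
    (v : C.Vertex) : ZMod 2 :=
  if h : (C.StarMeets v A ∧ C.StarMeets v Aᶜ) ∧ v ≠ v₀ then i ⟨v, h⟩ else 0

theorem boundaryWeight_add (A : Finset C.Edge) (v₀ : C.Vertex)
    (i j : C.BoundaryVertex A v₀ → ZMod 2) : C.boundaryWeight A v₀ (i + j) =
      C.boundaryWeight A v₀ i + C.boundaryWeight A v₀ j := by
  funext v
  by_cases h : (C.StarMeets v A ∧ C.StarMeets v Aᶜ) ∧ v ≠ v₀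
  · simp only [boundaryWeight, dif_pos h, Pi.add_apply]
  · simp only [boundaryWeight, dif_neg h, Pi.add_apply, add_zero]

theorem boundaryWeight_eq_zero {A : Finset C.Edge} {v₀ : C.Vertex}
    (i : C.BoundaryVertex A v₀ → ZMod 2) {v : C.Vertex}
    (hv : ¬ (C.StarMeets v A ∧ C.StarMeets v Aᶜ)) : C.boundaryWeight A v₀ i v = 0 :=
  dif_neg fun h => hv h.1

/-- The product of boundary stars with given weights. -/
def boundaryVec (A : Finset C.Edge) (v₀ : C.Vertex) (i : C.BoundaryVertex A v₀ → ZMod 2) :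
    C.Edge → ZMod 2 :=
  C.coboundary (C.boundaryWeight A v₀ i)

theorem boundaryVec_add (A : Finset C.Edge) (v₀ : C.Vertex)
    (i j : C.BoundaryVertex A v₀ → ZMod 2) :
    C.boundaryVec A v₀ (i + j) = C.boundaryVec A v₀ i + C.boundaryVec A v₀ j := by
  rw [boundaryVec, boundaryWeight_add, coboundary_add]; rfl

/-- Applied to `A₂` and `B₂`, this confines the displacements of the branches to `A₁` and `B₁`. -/
theorem boundaryVec_eq_zero {A : Finset C.Edge} {v₀ : C.Vertex}
    (i : C.BoundaryVertex A v₀ → ZMod 2) {R : Finset C.Edge}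
    (hR : ∀ v, C.StarMeets v R → ¬ (C.StarMeets v A ∧ C.StarMeets v Aᶜ)) {e : C.Edge}
    (he : e ∈ R) : C.boundaryVec A v₀ i e = 0 := by
  rw [boundaryVec, C.coboundary_congr (g := 0) (fun v hv => C.boundaryWeight_eq_zero i (hR v hv)) he,
    coboundary_zero]; rfl

variable {C} in
/-- Distinct boundary labels are distinguished inside the disc. -/
theorem IsDisc.eq_zero_of_circulation_mask {A : Finset C.Edge} (hA : C.IsDisc A) {v₀ : C.Vertex}
    (h₀ : C.StarMeets v₀ A ∧ C.StarMeets v₀ Aᶜ) (i : C.BoundaryVertex A v₀ → ZMod 2)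
    (h : ∀ p, C.circulation (mask A (C.boundaryVec A v₀ i)) p = 0) : i = 0 := by
  obtain ⟨g, hg0, hg⟩ := hA.exists_interior_coboundary (s := mask A _) (fun e he => if_neg he) h
  have hz : ∀ e ∈ A, C.coboundary (C.boundaryWeight A v₀ i + g) e = 0 := by
    intro e he
    rw [coboundary_add, ← hg, Pi.add_apply, mask, if_pos he]
    exact ZMod.two_add_self _
  -- The total weight is constant on the disc, and it is 0 at `v₀`, where the boundary weight is 0
  -- by normalisation and `g` by being interior.
  funext ⟨v, hv⟩
  have h1 := hA.connected.eq_of_coboundary_eq_zero hz hv.1.1 h₀.1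
  have h2 : C.boundaryWeight A v₀ i v = i ⟨v, hv⟩ := dif_pos hv
  have h3 : C.boundaryWeight A v₀ i v₀ = 0 := dif_neg fun h => h.2 rfl
  rw [Pi.add_apply, Pi.add_apply, hg0 v hv.1.2, hg0 v₀ h₀.2, h2, h3] at h1
  simpa using h1

variable {C} in
/-- Every admissible configuration becomes closed inside the disc after acting with boundary
stars. -/
theorem IsDisc.exists_circulation_mask_eq_zero {A : Finset C.Edge} (hA : C.IsDisc A)
    {P : Finset C.Face} (hAP : ∀ p, C.PlaquetteMeets p A → p ∈ P) (v₀ : C.Vertex)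
    {s : C.Edge → ZMod 2} (hs : ∀ p ∈ P, C.circulation s p = 0) :
    ∃ i, ∀ p, C.circulation (mask A (s + C.boundaryVec A v₀ i)) p = 0 := by
  classical
  obtain ⟨f, hf⟩ := hA.exists_coboundary (s := s) (by
    intro p hp
    refine hs p (hAP p ?_)
    obtain ⟨x, rfl⟩ := C.face_surjective p
    by_cases hx : C.edge x ∈ A
    · exact ⟨x, rfl, hx⟩
    · exact (hp ⟨x, rfl, Finset.mem_compl.mpr hx⟩).elim)
  -- Adding the constant `f v₀` normalises `f` at `v₀` without changing its coboundary. The label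
  -- `i` then cancels it at the other boundary vertices, leaving the interior weight `h`.
  let i : C.BoundaryVertex A v₀ → ZMod 2 := fun v => f v + f v₀
  let h : C.Vertex → ZMod 2 := fun v =>
    if C.StarMeets v Aᶜ then 0 else f v + f v₀ + C.boundaryWeight A v₀ i v
  refine ⟨i, fun p => ?_⟩
  have hh : mask A (s + C.boundaryVec A v₀ i) = C.coboundary h := by
    funext e
    by_cases he : e ∈ A
    · rw [mask, if_pos he, Pi.add_apply, hf e he, boundaryVec]
      have e1 : C.coboundary h e =
          C.coboundary (f + fun _ => f v₀) e + C.coboundary (C.boundaryWeight A v₀ i) e := by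
        rw [← Pi.add_apply, ← coboundary_add]
        refine C.coboundary_congr (fun v hv => ?_) he
        by_cases hv' : C.StarMeets v Aᶜ
        · simp only [h, if_pos hv', Pi.add_apply]
          by_cases hv0 : v = v₀
          · subst hv0
            rw [boundaryWeight, dif_neg fun h => h.2 rfl, ZMod.two_add_self, add_zero]
          · rw [boundaryWeight, dif_pos ⟨⟨hv, hv'⟩, hv0⟩, ZMod.two_add_self]
        · simp only [h, if_neg hv', Pi.add_apply]
      have e2 : C.coboundary (fun _ => f v₀) e = 0 := by
        obtain ⟨x, rfl⟩ := C.edge_surjective e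
        rw [coboundary_edge]; exact ZMod.two_add_self _
      rw [e1, coboundary_add, Pi.add_apply, e2, add_zero]
    · rw [mask, if_neg he, C.coboundary_congr (f := h) (g := 0) (R := Aᶜ) (fun v hv => if_pos hv)
        (Finset.mem_compl.mpr he), coboundary_zero]; rfl
  rw [hh, circulation_coboundary]

/-- If a displacement on `R₂`, away from the border of `R`, closes the restriction of a product of
stars to `R`, then that restriction is already closed. -/
theorem circulation_mask_coboundary {P : Finset C.Face} {R R₂ : Finset C.Edge}
    (hR : ∀ p, ¬ (C.PlaquetteMeets p R₂ ∧ C.PlaquetteMeets p Rᶜ)) {y : C.Edge → ZMod 2}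
    (hy : ∀ e ∉ R₂, y e = 0) (f : C.Vertex → ZMod 2)
    (h : ∀ p ∈ P, C.circulation (y + mask R (C.coboundary f)) p = 0) :
    ∀ p ∈ P, C.circulation (mask R (C.coboundary f)) p = 0 := by
  intro p hp
  -- A face meeting `R₂` lies wholly in `R`, where the mask changes nothing and the coboundary is
  -- closed; any other face does not see `y`.
  by_cases h2 : C.PlaquetteMeets p R₂
  · rw [C.circulation_congr (t := C.coboundary f), circulation_coboundary]
    intro x hx
    refine if_pos ?_
    by_contra hxR
    exact hR p ⟨h2, x, hx, Finset.mem_compl.mpr hxR⟩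
  · rw [← h p hp]
    refine C.circulation_congr fun x hx => ?_
    rw [Pi.add_apply, hy _ fun hxR => h2 ⟨x, hx, hxR⟩, zero_add]

open Classical in
/-- The indicator of the configurations satisfying all plaquettes in `P`. -/
def closedIndicator (P : Finset C.Face) (s : C.Edge → ZMod 2) : ℂ :=
  if ∀ p ∈ P, C.circulation s p = 0 then 1 else 0

theorem closedIndicator_ne_zero {P : Finset C.Face} {s : C.Edge → ZMod 2} :
    C.closedIndicator P s ≠ 0 ↔ ∀ p ∈ P, C.circulation s p = 0 := by
  unfold closedIndicator
  split_ifs with h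
  · exact iff_of_true one_ne_zero h
  · exact iff_of_false (not_not.mpr rfl) h

variable {C} in
/-- The Schmidt decomposition of a toric code ground state across the boundary of a disc. -/
theorem IsDisc.schmidt {A : Finset C.Edge} (hA : C.IsDisc A) {S : Finset C.Vertex}
    {P : Finset C.Face} (hAS : ∀ v, C.StarMeets v A → v ∈ S)
    (hAP : ∀ p, C.PlaquetteMeets p A → p ∈ P) {v₀ : C.Vertex}
    (h₀ : C.StarMeets v₀ A ∧ C.StarMeets v₀ Aᶜ) {ψ : (C.Edge → ZMod 2) → ℂ}
    (hS : ∀ v ∈ S, ∀ s, ψ (s + C.starVec v) = ψ s)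
    (hP : ∀ s, ψ s ≠ 0 → ∀ p ∈ P, C.circulation s p = 0) (s : C.Edge → ZMod 2) :
    ψ s = ∑ i : C.BoundaryVertex A v₀ → ZMod 2, C.closedIndicator P (mask A (s + C.boundaryVec A v₀ i)) *
      ψ (mask Aᶜ (s + C.boundaryVec A v₀ i)) := by
  classical
  have hshift : ∀ i s, ψ (s + C.boundaryVec A v₀ i) = ψ s := by
    intro i s
    refine apply_add_coboundary hS (fun v hv => hAS v ?_) s
    by_contra h
    exact hv (C.boundaryWeight_eq_zero i fun h' => h h'.1)
  by_cases hs : ∀ p ∈ P, C.circulation s p = 0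
  · obtain ⟨i, hi⟩ := hA.exists_circulation_mask_eq_zero hAP v₀ hs
    -- Exactly one label closes the part of `s` in the disc, so the sum has a single term.
    rw [Finset.sum_eq_single i]
    · rw [closedIndicator, if_pos fun p _ => hi p, one_mul, ← hshift i s]
      conv_lhs => rw [← mask_add_mask_compl A (s + C.boundaryVec A v₀ i), add_comm]
      -- The closed part in `A` is a product of interior stars, so it can be erased without changing
      -- `ψ`.
      obtain ⟨f, hf0, hf⟩ := hA.exists_interior_coboundary (s := mask A _)
        (fun e he => if_neg he) hi
      rw [hf]
      refine apply_add_coboundary hS (fun v hv => hAS v ?_) _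
      exact (C.starMeets_or_compl v A).resolve_right fun h => hv (hf0 v h)
    · intro j _ hji
      by_contra hne
      have hj := C.circulation_mask_eq_zero hAP
        (C.closedIndicator_ne_zero.mp (left_ne_zero_of_mul hne))
      have hz : j + i = 0 := by
        refine hA.eq_zero_of_circulation_mask h₀ _ fun p => ?_
        have e1 : mask A (C.boundaryVec A v₀ (j + i)) =
            mask A (s + C.boundaryVec A v₀ j) + mask A (s + C.boundaryVec A v₀ i) := by
          rw [← mask_add, boundaryVec_add]
          congr 1
          funext e
          simp only [Pi.add_apply]
          linear_combination -ZMod.two_add_self (s e)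
        rw [e1, circulation_add, Pi.add_apply, hi, hj, add_zero]
      exact hji (funext fun v => ZMod.two_eq_of_add_eq_zero (congrFun hz v))
    · simp
  -- For inadmissible `s` both sides vanish: if both parts of a shift of `s` were closed, so would
  -- be `s`.
  · have h0 : ψ s = 0 := by
      by_contra h; exact hs (hP s h)
    rw [h0]
    symm
    refine Finset.sum_eq_zero fun i _ => ?_
    by_contra hne
    have e1 := C.closedIndicator_ne_zero.mp (left_ne_zero_of_mul hne)
    have e2 := hP _ (right_ne_zero_of_mul hne)
    refine hs fun p hp => ?_
    have := congrArg (fun t => C.circulation t p)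
      (mask_add_mask_compl A (s + C.boundaryVec A v₀ i))
    simp only [circulation_add, Pi.add_apply, boundaryVec, circulation_coboundary, add_zero]
      at this
    rw [← this]
    exact (congrArg₂ (· + ·) (e1 p hp) (e2 p hp)).trans (add_zero 0)

theorem card_boundaryLabels (A : Finset C.Edge) {v₀ : C.Vertex}
    (h₀ : C.StarMeets v₀ A ∧ C.StarMeets v₀ Aᶜ)
    [Fintype (C.BoundaryVertex A v₀ → ZMod 2)] :
    Fintype.card (C.BoundaryVertex A v₀ → ZMod 2) =
      2 ^ (Set.ncard {v | C.StarMeets v A ∧ C.StarMeets v Aᶜ} - 1) := by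
  classical
  rw [← Nat.card_eq_fintype_card, Nat.card_fun, Nat.card_zmod,
    ← Set.ncard_sdiff_singleton_of_mem (show v₀ ∈ {v | C.StarMeets v A ∧ C.StarMeets v Aᶜ} from h₀)]
  rfl

-- The branches on either side have orthogonal column spaces in the untraced part, so the negativity
-- counts the boundary labels.
variable {C} in
theorem IsDisc.logNegativity_eq {S : Finset C.Vertex} {P : Finset C.Face} {U J : ℝ} (hU : 0 < U)
    (hJ : 0 < J) {A A₁ A₂ B₁ B₂ : Finset C.Edge} (hA₁₂ : A = A₁ ∪ A₂) (hA_disj : Disjoint A₁ A₂)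
    (hB₁₂ : Aᶜ = B₁ ∪ B₂) (hB_disj : Disjoint B₁ B₂) (hA : C.IsDisc A)
    (hAS : ∀ v, C.StarMeets v A → v ∈ S) (hAP : ∀ p, C.PlaquetteMeets p A → p ∈ P)
    (hA₂ : C.NoBorder A₂ Aᶜ) (hB₂ : C.NoBorder B₂ A)
    {ψ : (C.Edge → Fin 2) → ℂ} (hψ : IsGroundState (C.hamiltonian S P U J) ψ) :
    logNegativity (reducedState (pureState ψ) A₁ B₁) = (C.numSpanning P A Aᶜ : ℝ) - 1 := by
  classical
  obtain ⟨hS, hP⟩ := IsGroundState.stabilized hU hJ hψ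
  obtain ⟨x₀, hx₀⟩ := hA.boundary_nonempty
  have h₀ : C.StarMeets (C.vertex x₀) A ∧ C.StarMeets (C.vertex x₀) Aᶜ :=
    ⟨⟨x₀, rfl, hx₀.1⟩, C.a1 x₀, C.vertex_a1 x₀, Finset.mem_compl.mpr hx₀.2⟩
  generalize C.vertex x₀ = v₀ at h₀
  have mA : ∀ e, e ∈ A ↔ e ∈ A₁ ∨ e ∈ A₂ := fun e => by rw [hA₁₂, Finset.mem_union]
  have mB : ∀ e, e ∉ A ↔ e ∈ B₁ ∨ e ∈ B₂ := fun e => by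
    rw [← Finset.mem_compl, hB₁₂, Finset.mem_union]
  have dA : ∀ e ∈ A₁, e ∉ A₂ := fun e => (Finset.disjoint_left.mp hA_disj ·)
  have dB : ∀ e ∈ B₁, e ∉ B₂ := fun e => (Finset.disjoint_left.mp hB_disj ·)
  have hAB₁ : Disjoint A₁ B₁ := Finset.disjoint_left.mpr fun e h h' =>
    (mB e).mpr (Or.inl h') ((mA e).mpr (Or.inl h))
  have hcover : ∀ e, e ∈ A₁ ∨ e ∈ A₂ ∨ e ∈ B₁ ∨ e ∈ B₂ := fun e => by
    have := mA e; have := mB e; tauto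
  have hX' : ∀ e ∈ A₂, e ∉ A₁ ∧ e ∉ B₁ ∧ e ∉ B₂ := fun e => by
    have := mA e; have := mB e; have := dA e; tauto
  have hY' : ∀ e ∈ B₂, e ∉ A₁ ∧ e ∉ B₁ := fun e => by
    have := mA e; have := mB e; have := dB e; tauto
  let l := C.boundaryVec A v₀
  let u := branch A₁ A₂ (C.closedIndicator P) (fun i => mask A (l i))
  let w := branch B₁ B₂ ψ (fun i => mask Aᶜ (l i))
  have hρ := reducedState_eq_sum_kronecker hcover hX' hY' hAB₁ (C.closedIndicator P) ψ l ψ (by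
    intro s
    rw [← hA₁₂, ← hB₁₂]
    exact hA.schmidt hAS hAP h₀ hS hP s)
  rw [← hA₁₂, ← hB₁₂] at hρ
  -- Two configurations in the same row of a branch differ only on the traced out region, away from
  -- the border, and such a difference cannot hide the label.
  have hjoin : ∀ (X Y : Finset C.Edge) (a : {e // e ∈ X} → ZMod 2)
      (c c' : {e // e ∈ Y} → ZMod 2), ∀ e ∉ Y, (join X Y a c + join X Y a c') e = 0 := by
    intro X Y a c c' e he
    by_cases hX : e ∈ X
    · simp only [Pi.add_apply, join, dif_pos hX]; exact ZMod.two_add_self _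
    · simp [join, hX, he]
  have hclosed : ∀ (X Y R : Finset C.Edge) a c c' i j,
      (∀ p, ¬ (C.PlaquetteMeets p Y ∧ C.PlaquetteMeets p Rᶜ)) →
      (∀ p ∈ P, C.circulation (join X Y a c + mask R (l i)) p = 0) →
      (∀ p ∈ P, C.circulation (join X Y a c' + mask R (l j)) p = 0) →
      ∀ p ∈ P, C.circulation (mask R (l (i + j))) p = 0 := by
    intro X Y R a c c' i j hR hi hj
    refine C.circulation_mask_coboundary hR (hjoin X Y a c c') _ fun p hp => ?_
    have e1 := hi p hp
    have e2 := hj p hp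
    have e3 : mask R (l (i + j)) = mask R (l i) + mask R (l j) := by
      rw [← mask_add, ← boundaryVec_add]
    change C.circulation (_ + mask R (l (i + j))) p = 0
    rw [e3]
    rw [circulation_add, Pi.add_apply] at e1 e2 ⊢
    rw [circulation_add, circulation_add, Pi.add_apply, Pi.add_apply]
    linear_combination e1 + e2
  have hlabel : ∀ i j, (∀ p ∈ P, C.circulation (mask A (l (i + j))) p = 0) → i = j := by
    intro i j h
    have := hA.eq_zero_of_circulation_mask h₀ (i + j) (C.circulation_mask_eq_zero hAP h)
    exact funext fun v => ZMod.two_eq_of_add_eq_zero (congrFun this v)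
  have hu := branch_conjTranspose_mul A₁ A₂ (C.closedIndicator P) (fun i => mask A (l i))
    (fun i e he => by
      rw [mask]
      split_ifs with h
      · have he2 : e ∈ A₂ := ((mA e).mp h).resolve_left he
        exact C.boundaryVec_eq_zero i (fun v hv hv' => hA₂.1 v ⟨hv, hv'.2⟩) he2
      · rfl)
    (fun i j a c c' hi hj => hlabel i j (hclosed A₁ A₂ A a c c' i j hA₂.2
      (C.closedIndicator_ne_zero.mp hi) (C.closedIndicator_ne_zero.mp hj)))
  have hw := branch_conjTranspose_mul B₁ B₂ ψ (fun i => mask Aᶜ (l i))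
    (fun i e he => by
      rw [mask]
      split_ifs with h
      · have he2 : e ∈ B₂ := ((mB e).mp (Finset.mem_compl.mp h)).resolve_left he
        exact C.boundaryVec_eq_zero i (fun v hv hv' => hB₂.1 v ⟨hv, hv'.1⟩) he2
      · rfl)
    -- `B` need not be a disc. A product of stars is closed as a whole, so closedness of its part in
    -- `B` passes to its part in `A`, where the disc identifies the label.
    (fun i j a c c' hi hj => by
      refine hlabel i j fun p hp => ?_
      have h1 := hclosed B₁ B₂ Aᶜ a c c' i j (by rw [compl_compl]; exact hB₂.2)
        (hP _ hi) (hP _ hj) p hp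
      have h2 : C.circulation (l (i + j)) p = 0 := C.circulation_coboundary _ p
      rw [← mask_add_mask_compl A (l (i + j)), circulation_add, Pi.add_apply, h1, add_zero] at h2
      exact h2)
  have htr : (∑ i, ∑ j, (u i * (u j)ᴴ) ⊗ₖ (w i * (w j)ᴴ)).trace = 1 := by
    rw [← hρ]
    refine (trace_reducedState hAB₁ ψ).trans ?_
    rw [hψ.1, Complex.ofReal_one]
  have hlog := logNegativity_sum_kronecker u w _ _ hu hw htr
  rw [← hρ] at hlog
  refine Eq.trans ?_ (hlog.trans ?_)
  · rfl
  have hpos : 0 < Set.ncard {v | C.StarMeets v A ∧ C.StarMeets v Aᶜ} :=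
    (Set.ncard_pos).mpr ⟨v₀, h₀⟩
  have hspan : C.numSpanning P A Aᶜ = Set.ncard {v | C.StarMeets v A ∧ C.StarMeets v Aᶜ} := by
    rw [hA.ncard_boundary_vertices_eq, numSpanning]
    congr 1
    ext p
    exact ⟨fun h => h.2, fun h => ⟨hAP p h.1, h⟩⟩
  rw [C.card_boundaryLabels A h₀, hspan, Nat.cast_pow, Nat.cast_two, Real.logb_pow,
    Real.logb_self_eq_one one_lt_two, mul_one, Nat.cast_sub hpos, Nat.cast_one]

end SurfaceLattice

theorem mainTheorem3 {Φ : Type*} [Finite Φ] (C : SurfaceLattice Φ)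
    (S : Finset C.Vertex) (P : Finset C.Face) (U J : ℝ) (hU : 0 < U) (hJ : 0 < J)
    (A B A₁ A₂ B₁ B₂ : Finset C.Edge) (hB : B = Aᶜ)
    (hA₁₂ : A = A₁ ∪ A₂) (hA_disj : Disjoint A₁ A₂)
    (hB₁₂ : B = B₁ ∪ B₂) (hB_disj : Disjoint B₁ B₂)
    (hA : C.IsDisc A)
    (hAS : ∀ v, C.StarMeets v A → v ∈ S) (hAP : ∀ p, C.PlaquetteMeets p A → p ∈ P)
    (hA₂ : C.NoBorder A₂ B) (hB₂ : C.NoBorder B₂ A)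
    (ψ : (C.Edge → Fin 2) → ℂ) (hψ : IsGroundState (C.hamiltonian S P U J) ψ) :
    logNegativity (reducedState (pureState ψ) A₁ B₁) = (C.numSpanning P A B : ℝ) - 1 ∧
      logNegativity (reducedState (pureState ψ) A B) = (C.numSpanning P A B : ℝ) - 1 := by
  subst hB
  exact ⟨hA.logNegativity_eq hU hJ hA₁₂ hA_disj hB₁₂ hB_disj hAS hAP hA₂ hB₂ hψ,
    -- The full bipartition is the case where nothing is traced out, `A₂ = B₂ = ∅`.
    hA.logNegativity_eq hU hJ (Finset.union_empty A).symm (Finset.disjoint_empty_right A)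
      (Finset.union_empty Aᶜ).symm (Finset.disjoint_empty_right _) hAS hAP
      (C.noBorder_empty _) (C.noBorder_empty _) hψ⟩
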